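/- Let $X=\{X_t\}_{t\ge 0}$ be a real-valued Lévy process with generator $\mathcal L$, and let $(P_t^*\varphi)(y)=\mathrm E\,\varphi(y-X_t)$. Let $w$ be space-time white noise on $\mathbf R_+\times\mathbf R$ defined on a complete probability space $(\Omega,\mathscr F,\mathrm P)$, i.e. a centered Gaussian process $\{w(f)\}_{f\in L^2(\mathbf R_+\times\mathbf R)}$ with $\mathrm E[w(f)w(g)]=\int_0^\infty\int_{-\infty}^\infty fg\,dx\,ds$. The weak solution of the linear stochastic heat equation $\partial_t H=\mathcal L H+\dot w$, $H(0,\cdot)=0$, is $$H(t,\varphi)=\int_0^t\int_{-\infty}^\infty (P^*_{t-s}\varphi)(y)\,w(dy\,ds),\qquad t\ge 0,\ \varphi\in\mathscr S(\mathbf R).$$ The equation has a random-field solution $H=\{H(t,x)\}_{t\ge0,x\in\mathbf R}$ if, for every $t\ge0$ and $x\in\mathbf R$, there are $\varphi_n\in\mathscr S(\mathbf R)$ with $\varphi_n\to\delta_x$ in the sense of distributions and $H(t,\varphi_n)\to H(t,x)$ in $L^2(\mathrm P)$. **Theorem.** Let $b:\mathbf R\to\mathbf R$ be bounded and globally Lipschitz,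 and suppose the linear stochastic heat equation has a random-field solution $H$. Then $X$ has a jointly measurable transition density $\{p_t(x)\}_{t>0,x\in\mathbf R}$, and there exist a modification of $H$, still denoted $H$, and a process $H_b=\{H_b(t,x)\}_{t\ge0,x\in\mathbf R}$, both jointly measurable in $(t,x,\omega)$, with the following properties. 1. Almost surely, $H_b\in L^p_{\rm loc}(\mathbf R_+\times\mathbf R)$ for all $p\in[1,\infty)$. 2. With probability one, for all $(t,x)\in\mathbf R_+\times\mathbf R$ simultaneously, $$H_b(t,x)=H(t,x)+\int_0^t\int_{-\infty}^\infty b(H_b(s,x-y))\,p_{t-s}(y)\,dy\,ds,$$ where the integrand is integrable on $(0,t)\times\mathbf R$. 3. Almost surely, for all $T>0$, the function $$J(t,x):=\int_0^t\int_{-\infty}^\infty b(H_b(s,x-y))\,p_{t-s}(y)\,dy\,ds$$ is bounded and continuous on $[0,T]\times\mathbf R$. Consequently, almost surely: for every $(t,x)\in\mathbf R_+\times\mathbf R$, $H_b$ is continuous at $(t,x)$ if and only if $H$ is, and $H_b$ is unbounded on every neighbourhood of $(t,x)$ in $\mathbf R_+\times\mathbf R$ if and only if $H$ is; and for every $T>0$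 and every $A\subseteq[0,T]\times\mathbf R$, $H_b$ is bounded on $A$ if and only if $H$ is. -/

import Mathlib

open MeasureTheory ProbabilityTheory Filter Topology
open scoped NNReal ENNReal SchwartzMap

noncomputable section

namespace SemilinearHeat

/-- A real-valued Lévy process: it starts at `0`, has independent and stationary increments, and is
continuous in probability. -/
structure IsLevyProcess {Ω' : Type*} [MeasurableSpace Ω'] (X : ℝ≥0 → Ω' → ℝ) (P' : Measure Ω') :
    Prop where
  measurable : ∀ t, Measurable (X t)
  zero : ∀ᵐ ω ∂P', X 0 ω = 0
  indep : HasIndepIncrements X P'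
  stationary : ∀ s t : ℝ≥0, P'.map (fun ω => X (s + t) ω - X s ω) = P'.map (X t)
  continuousInProb : ∀ t : ℝ≥0, TendstoInMeasure P' X (𝓝 t) (X t)

/-- The space-time domain `ℝ₊ × ℝ` as a subset of `ℝ × ℝ` (first coordinate: time). -/
def spaceTime : Set (ℝ × ℝ) := Set.Ici 0 ×ˢ Set.univ

/-- Lebesgue measure on `ℝ₊ × ℝ`. -/
def spaceTimeMeasure : Measure (ℝ × ℝ) := volume.restrict spaceTime

/-- Space-time white noise on `ℝ₊ × ℝ`, as the iso-Gaussian process `f ↦ w(f) = ∫ f dw` indexed by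
`L²(ℝ₊ × ℝ)`: a centered Gaussian process with `E[w(f) w(g)] = ⟪f, g⟫`. -/
structure IsWhiteNoise {Ω : Type*} [MeasurableSpace Ω] (w : Lp ℝ 2 spaceTimeMeasure → Ω → ℝ)
    (P : Measure Ω) : Prop where
  gaussian : IsGaussianProcess w P
  mean : ∀ f, ∫ ω, w f ω ∂P = 0
  cov : ∀ f g, ∫ ω, w f ω * w g ω ∂P = inner ℝ f g

open Classical in
/-- The Wiener integral `∫ f dw` of a square-integrable function `f` on `ℝ₊ × ℝ`
(with the value `0` when `f` is not square integrable). -/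
def wienerIntegral {Ω : Type*} (w : Lp ℝ 2 spaceTimeMeasure → Ω → ℝ) (f : ℝ × ℝ → ℝ) : Ω → ℝ :=
  if h : MemLp f 2 spaceTimeMeasure then w (h.toLp f) else 0

/-- The dual semigroup `(P*_r φ)(y) = E φ(y - X_r)`, for `r ≥ 0`. -/
def dualSemigroup {Ω' : Type*} [MeasurableSpace Ω'] (X : ℝ≥0 → Ω' → ℝ) (P' : Measure Ω')
    (r : ℝ) (φ : ℝ → ℝ) (y : ℝ) : ℝ :=
  ∫ ω', φ (y - X r.toNNReal ω') ∂P'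

/-- The weak solution `H(t, φ) = ∫₀ᵗ ∫ (P*_{t-s} φ)(y) w(dy ds)`, for `t ≥ 0`, of the linear
stochastic heat equation `∂ₜ H = 𝓛 H + ẇ`, `H(0, ·) = 0`, where `𝓛` is the generator of `X`. -/
def weakSolution {Ω Ω' : Type*} [MeasurableSpace Ω'] (w : Lp ℝ 2 spaceTimeMeasure → Ω → ℝ)
    (X : ℝ≥0 → Ω' → ℝ) (P' : Measure Ω') (t : ℝ) (φ : 𝓢(ℝ, ℝ)) : Ω → ℝ :=
  wienerIntegral w
    (fun z => if z.1 ≤ t then dualSemigroup X P' (t - z.1) (fun x => φ x) z.2 else 0)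

/-- `φₙ → δₓ` in the sense of Schwartz distributions. -/
def TendstoDirac (φ : ℕ → 𝓢(ℝ, ℝ)) (x : ℝ) : Prop :=
  ∀ ψ : ℝ → ℝ, ContDiff ℝ (⊤ : ℕ∞) ψ → HasCompactSupport ψ →
    Tendsto (fun n => ∫ y, φ n y * ψ y) atTop (𝓝 (ψ x))

/-- `H` is a random-field solution of the linear stochastic heat equation: for every `t ≥ 0` and
every `x`, the point mass `δₓ` lies in the completion of `𝓢(ℝ)` inside the Schwartz distributions
with respect to the metric `d_t(φ, ψ) = (E |H(t, φ) - H(t, ψ)|²)^{1/2}`, and `H(t, x) = H(t, δₓ)` is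
the value at `δₓ` of the extension of `φ ↦ H(t, φ)` to that completion. -/
def IsRandomFieldSolution {Ω Ω' : Type*} [MeasurableSpace Ω] [MeasurableSpace Ω']
    (w : Lp ℝ 2 spaceTimeMeasure → Ω → ℝ) (P : Measure Ω)
    (X : ℝ≥0 → Ω' → ℝ) (P' : Measure Ω') (H : ℝ → ℝ → Ω → ℝ) : Prop :=
  ∀ t : ℝ, 0 ≤ t → ∀ x : ℝ, Measurable (H t x) ∧
    ∃ φ : ℕ → 𝓢(ℝ, ℝ), TendstoDirac φ x ∧
      Tendsto (fun n => eLpNorm (fun ω => weakSolution w X P' t (φ n) ω - H t x ω) 2 P)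
        atTop (𝓝 0)

/-- `p` is a jointly measurable transition density of `X`: for each `t > 0`, `X_t` has the law
`p_t(x) dx`. -/
structure IsTransitionDensity {Ω' : Type*} [MeasurableSpace Ω'] (X : ℝ≥0 → Ω' → ℝ)
    (P' : Measure Ω') (p : ℝ → ℝ → ℝ) : Prop where
  measurable : Measurable (fun z : ℝ × ℝ => p z.1 z.2)
  nonneg : ∀ t x, 0 ≤ p t x
  law : ∀ t : ℝ, 0 < t →
    P'.map (X t.toNNReal) = volume.withDensity (fun x => ENNReal.ofReal (p t x))

/-- The integral `∫₀ᵗ ∫ b(u(s, x - y)) p_{t-s}(y) dy ds`. -/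
def driftIntegral (b : ℝ → ℝ) (p u : ℝ → ℝ → ℝ) (t x : ℝ) : ℝ :=
  ∫ s in (0 : ℝ)..t, ∫ y, b (u s (x - y)) * p (t - s) y

/-- The integrand of `driftIntegral` is Lebesgue integrable on `(0, t) × ℝ`. -/
def DriftIntegrable (b : ℝ → ℝ) (p u : ℝ → ℝ → ℝ) (t x : ℝ) : Prop :=
  IntegrableOn (fun z : ℝ × ℝ => b (u z.1 (x - z.2)) * p (t - z.1) z.2)
    (Set.Ioo 0 t ×ˢ Set.univ)

/-- `f ∈ L^q_loc(ℝ₊ × ℝ)`. -/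
def MemLpLoc (f : ℝ → ℝ → ℝ) (q : ℝ≥0∞) : Prop :=
  ∀ K : Set (ℝ × ℝ), IsCompact K → K ⊆ spaceTime →
    MemLp (fun z : ℝ × ℝ => f z.1 z.2) q (volume.restrict K)

/-- `f` is bounded on `A`. -/
def BoundedOn (f : ℝ → ℝ → ℝ) (A : Set (ℝ × ℝ)) : Prop :=
  ∃ C : ℝ, ∀ z ∈ A, |f z.1 z.2| ≤ C

/-- `f` blows up at `z ∈ ℝ₊ × ℝ`: it is unbounded on every neighbourhood of `z` in `ℝ₊ × ℝ`. -/
def BlowsUpAt (f : ℝ → ℝ → ℝ) (z : ℝ × ℝ) : Prop :=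
  ∀ U ∈ 𝓝 z, ¬ BoundedOn f (U ∩ spaceTime)

end SemilinearHeat

end

noncomputable section

namespace SemilinearHeat

open scoped FourierTransform ComplexConjugate LineDeriv

/-! ### The symbol and exponent of a Lévy process, and a lower bound for its energy. -/

section LevySymbol

variable {Ω' : Type*} [MeasurableSpace Ω'] {X : ℝ≥0 → Ω' → ℝ} {P' : Measure Ω'}

/-! The proof has a linear half, which extracts analytic information from the mere existence of `H`,
and a pathwise nonlinear half.

Linear half. Put `k_t(ξ) = ∫₀ᵗ |E exp(-2πiξX_r)|² dr`. By the white noise isometry and Plancherel in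
space, `E|H(t, φ)|² = ∫ |φ̂|² k_t dξ`, so convergence of `H(t, φₙ)` makes `φ̂ₙ` Cauchy in `L²(k_t
dξ)`. The crux is that the limit must be `exp(-2πiξx)`. Convergence `φₙ → δₓ` is tested only against
compactly supported functions, hence gives no direct control in frequency; a lower bound on `k_t`
supplies it. Since `1 - cos 2a ≤ 4(1 - cos a)`, the real part of a Lévy exponent grows at most
quadratically, so `k_t(ξ) ≥ c / (1 + ξ²)` (`exists_le_energy`). The energy norm therefore dominates
a Sobolev norm of order `-1`, in which the limit can be identified (`TendstoDirac.ae_eq_of_tendsto`,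
`TendstoDirac.tendsto_energy`).

Consequently `k_t` is integrable, which has two uses. First, the characteristic function of `X_r` is
integrable for `r > 0`, and Fourier inversion yields a density (`isTransitionDensity`). Second,
`H(t, x)` is `w` evaluated along an `L²`-continuous map of `(t, x)`
(`IsRandomFieldSolution.exists_continuous_kernel`), which yields a jointly measurable modification,
locally in every `L^q` by Gaussian moments.

Nonlinear half. For a fixed path, `v = H_b - H` solves `v = ∫∫ b(H + v) p`. As `b` is bounded and
Lipschitz and `p_t` has mass one, Picard's iteration converges with factorial bounds for any
measurable path, however irregular (`picardLimit_eq_driftIntegral`). The resulting `J` is the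
convolution of a bounded function with an integrable one, hence continuous
(`IsTransitionDensity.continuousOn_driftIntegral`), and `|J(t, x)| ≤ M t` with `M` a bound for
`|b|`. As `H_b = H + J`, continuity, boundedness and explosion transfer between `H_b` and `H`. -/

/-- The Fourier symbol `ξ ↦ E exp(-2π i ξ X_r)` of the law of `X_r`, for `r ≥ 0`. -/
def symbol (X : ℝ≥0 → Ω' → ℝ) (P' : Measure Ω') (r ξ : ℝ) : ℂ :=
  charFun (P'.map (X r.toNNReal)) (-2 * Real.pi * ξ)

/-- Convergence in probability gives almost sure convergence only along a subsequence. This suffices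
for a limit at a point: every sequence has a subsequence along which dominated convergence applies.
-/
lemma IsLevyProcess.continuous_integral_comp [IsProbabilityMeasure P'] (hX : IsLevyProcess X P')
    {E : Type*} [NormedAddCommGroup E] [NormedSpace ℝ E] {f : ℝ → E} (hf : Continuous f) {C : ℝ}
    (hC : ∀ x, ‖f x‖ ≤ C) : Continuous fun r : ℝ≥0 => ∫ ω, f (X r ω) ∂P' := by
  rw [continuous_iff_continuousAt]
  intro t
  refine tendsto_of_subseq_tendsto fun u hu => ?_
  have h1 : TendstoInMeasure P' (fun n => X (u n)) atTop (X t) := (hX.continuousInProb t).comp hu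
  obtain ⟨ns, -, hns⟩ := h1.exists_seq_tendsto_ae
  refine ⟨ns, tendsto_integral_of_dominated_convergence (fun _ => C) ?_ (integrable_const _) ?_ ?_⟩
  · intro n
    have := hX.measurable (u (ns n))
    exact hf.comp_aestronglyMeasurable this.aestronglyMeasurable
  · exact fun n => ae_of_all _ fun ω => hC _
  · filter_upwards [hns] with ω hω using (hf.tendsto _).comp hω

lemma symbol_eq_integral (hX : IsLevyProcess X P') (r ξ : ℝ) :
    symbol X P' r ξ = ∫ ω, Complex.exp ((-2 * Real.pi * ξ * X r.toNNReal ω : ℝ) * Complex.I) ∂P' := by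
  rw [symbol, charFun_apply_real, integral_map (hX.measurable _).aemeasurable (by fun_prop)]
  simp

lemma continuous_symbol_time [IsProbabilityMeasure P'] (hX : IsLevyProcess X P') (ξ : ℝ) :
    Continuous fun r => symbol X P' r ξ := by
  simp_rw [symbol_eq_integral hX]
  have := hX.continuous_integral_comp
    (f := fun x : ℝ => Complex.exp ((-2 * Real.pi * ξ * x : ℝ) * Complex.I)) (by fun_prop) (C := 1)
    (fun x => (Complex.norm_exp_ofReal_mul_I _).le)
  exact this.comp continuous_real_toNNReal

lemma isProbabilityMeasure_law [IsProbabilityMeasure P'] (hX : IsLevyProcess X P') (r : ℝ≥0) :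
    IsProbabilityMeasure (P'.map (X r)) :=
  Measure.isProbabilityMeasure_map (hX.measurable r).aemeasurable

lemma continuous_symbol_freq [IsProbabilityMeasure P'] (hX : IsLevyProcess X P') (r : ℝ) :
    Continuous fun ξ => symbol X P' r ξ := by
  have := isProbabilityMeasure_law hX r.toNNReal
  exact continuous_charFun.comp (by fun_prop)

lemma norm_symbol_le_one [IsProbabilityMeasure P'] (hX : IsLevyProcess X P') (r ξ : ℝ) :
    ‖symbol X P' r ξ‖ ≤ 1 := by
  have := isProbabilityMeasure_law hX r.toNNReal
  exact norm_charFun_le_one _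

/-- The symbol is separately continuous in time and frequency, which already forces joint
measurability. -/
lemma measurable_symbol [IsProbabilityMeasure P'] (hX : IsLevyProcess X P') :
    Measurable fun z : ℝ × ℝ => symbol X P' z.1 z.2 := by
  have := measurable_uncurry_of_continuous_of_measurable (u := fun r ξ => symbol X P' ξ r)
    (fun ξ => continuous_symbol_freq hX ξ)
    (fun r => (continuous_symbol_time hX r).measurable)
  exact this.comp measurable_swap

lemma symbol_zero [IsProbabilityMeasure P'] (hX : IsLevyProcess X P') (ξ : ℝ) :
    symbol X P' 0 ξ = 1 := by
  rw [symbol_eq_integral hX]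
  have : ∀ᵐ ω ∂P', Complex.exp ((-2 * Real.pi * ξ * X (0 : ℝ).toNNReal ω : ℝ) * Complex.I) = 1 := by
    filter_upwards [hX.zero] with ω hω
    simp [hω]
  rw [integral_congr_ae this]
  simp

lemma symbol_add [IsProbabilityMeasure P'] (hX : IsLevyProcess X P') {r s : ℝ} (hr : 0 ≤ r)
    (hs : 0 ≤ s) (ξ : ℝ) : symbol X P' (r + s) ξ = symbol X P' r ξ * symbol X P' s ξ := by
  have hi := hX.indep.indepFun_eval_sub (r := 0) (s := r.toNNReal) (t := r.toNNReal + s.toNNReal)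
    bot_le le_self_add hX.zero
  have h := hi.charFun_map_add_eq_mul (hX.measurable _).aemeasurable
    ((hX.measurable _).sub (hX.measurable _)).aemeasurable
  have e : X r.toNNReal + (X (r.toNNReal + s.toNNReal) - X r.toNNReal)
      = X (r.toNNReal + s.toNNReal) := by simp
  have e2 : P'.map (X (r.toNNReal + s.toNNReal) - X r.toNNReal) = P'.map (X s.toNNReal) :=
    hX.stationary _ _
  rw [e, e2] at h
  simp only [symbol, Real.toNNReal_add hr hs, h, Pi.mul_apply]

lemma symbol_neg [IsProbabilityMeasure P'] (r ξ : ℝ) :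
    symbol X P' r (-ξ) = conj (symbol X P' r ξ) := by
  rw [symbol, symbol, ← charFun_neg]
  congr 1
  ring

/-- The symbol at time `r` is a power of the symbol at time `r / 2 ^ n`, which is close to `1` for
large `n`. This makes the logarithm in `exponent` meaningful. -/
lemma symbol_ne_zero [IsProbabilityMeasure P'] (hX : IsLevyProcess X P') (r ξ : ℝ) :
    symbol X P' r ξ ≠ 0 := by
  rcases le_or_gt r 0 with hr | hr
  · have : symbol X P' r ξ = symbol X P' 0 ξ := by
      simp only [symbol, Real.toNNReal_of_nonpos hr, Real.toNNReal_zero]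
    rw [this, symbol_zero hX]
    exact one_ne_zero
  have hlim : Tendsto (fun n : ℕ => symbol X P' (r / 2 ^ n) ξ) atTop (𝓝 1) := by
    rw [← symbol_zero hX ξ]
    refine ((continuous_symbol_time hX ξ).tendsto 0).comp ?_
    have := (tendsto_pow_atTop_nhds_zero_of_lt_one (r := (1 / 2 : ℝ)) (by norm_num)
      (by norm_num)).const_mul r
    simpa [div_eq_mul_inv] using this
  obtain ⟨n, hn⟩ := (hlim.eventually_ne one_ne_zero).exists
  have : ∀ n : ℕ, symbol X P' (r / 2 ^ n) ξ ≠ 0 → symbol X P' r ξ ≠ 0 := by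
    intro n
    induction n with
    | zero => simp
    | succ k ih =>
      intro h
      apply ih
      have e : r / 2 ^ k = r / 2 ^ (k + 1) + r / 2 ^ (k + 1) := by
        rw [pow_succ]; ring
      rw [e, symbol_add hX (by positivity) (by positivity)]
      exact mul_ne_zero h h
  exact this n hn

/-- Twice the real part of the Lévy exponent, in the Fourier variable `2πξ`. -/
def exponent (X : ℝ≥0 → Ω' → ℝ) (P' : Measure Ω') (ξ : ℝ) : ℝ :=
  -Real.log (‖symbol X P' 1 ξ‖ ^ 2)

lemma exponent_nonneg [IsProbabilityMeasure P'] (hX : IsLevyProcess X P') (ξ : ℝ) :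
    0 ≤ exponent X P' ξ := by
  rw [exponent, neg_nonneg]
  exact Real.log_nonpos (by positivity) (pow_le_one₀ (norm_nonneg _) (norm_symbol_le_one hX _ _))

lemma continuous_exponent [IsProbabilityMeasure P'] (hX : IsLevyProcess X P') :
    Continuous (exponent X P') := by
  refine (Continuous.log ((continuous_symbol_freq hX 1).norm.pow 2) fun ξ => ?_).neg
  exact pow_ne_zero 2 (norm_ne_zero_iff.2 (symbol_ne_zero hX 1 ξ))

/-- The logarithm of the left side is continuous and additive in `r ≥ 0`, hence linear there. -/
lemma norm_symbol_sq [IsProbabilityMeasure P'] (hX : IsLevyProcess X P') {r : ℝ} (hr : 0 ≤ r)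
    (ξ : ℝ) : ‖symbol X P' r ξ‖ ^ 2 = Real.exp (-(r * exponent X P' ξ)) := by
  set g : ℝ → ℝ := fun r => Real.log (‖symbol X P' r ξ‖ ^ 2) with hg
  have hpos : ∀ r, 0 < ‖symbol X P' r ξ‖ ^ 2 := fun r => by
    have := symbol_ne_zero hX r ξ
    positivity
  have hadd : ∀ r s, 0 ≤ r → 0 ≤ s → g (r + s) = g r + g s := fun r s h1 h2 => by
    simp only [hg]
    rw [symbol_add hX h1 h2, norm_mul, mul_pow, Real.log_mul (hpos r).ne' (hpos s).ne']
  have hcont : Continuous g :=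
    ((continuous_symbol_time hX ξ).norm.pow 2).log fun r => (hpos r).ne'
  have h0 : g 0 = 0 := by simp [hg, symbol_zero hX]
  -- The odd extension of `g` to the whole line is additive, so the statement that continuous
  -- additive maps are linear applies to it.
  let A : ℝ →+ ℝ := AddMonoidHom.mk' (fun x => g (max x 0) - g (max (-x) 0)) (fun x y => by
    have key : ∀ a b c d e f : ℝ, 0 ≤ a → 0 ≤ b → 0 ≤ c → 0 ≤ d → 0 ≤ e → 0 ≤ f →
        a + d + f = b + c + e → g a + g d + g f = g b + g c + g e := by
      intro a b c d e f ha hb hc hd he hf h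
      rw [← hadd a d ha hd, ← hadd _ f (by positivity) hf, h, hadd _ e (by positivity) he,
        hadd b c hb hc]
    have := key (max (x + y) 0) (max (-(x + y)) 0) (max x 0) (max (-x) 0) (max y 0) (max (-y) 0)
      (by simp) (by simp) (by simp) (by simp) (by simp) (by simp) (by
        have e : ∀ z : ℝ, max z 0 - max (-z) 0 = z := fun z => by
          rcases le_total 0 z with h | h <;> simp [h]
        linarith [e x, e y, e (x + y)])
    linarith)
  have hA : Continuous A := by
    change Continuous fun x => g (max x 0) - g (max (-x) 0)
    fun_prop
  have hlin := map_real_smul A hA r 1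
  have e1 : A 1 = g 1 := by simp [A, h0]
  have e2 : A r = g r := by simp [A, h0, hr]
  simp only [smul_eq_mul, mul_one] at hlin
  rw [e1, e2] at hlin
  have : -(r * exponent X P' ξ) = g r := by rw [hlin, exponent]; simp [hg]
  rw [this, hg, Real.exp_log (hpos r)]

/-- Symmetrization: `|symbol|²` is the characteristic function of the difference of two independent
copies of `X_r`, hence an expectation of a cosine. -/
lemma one_sub_norm_symbol_sq [IsProbabilityMeasure P'] (hX : IsLevyProcess X P') (r ξ : ℝ) :
    1 - ‖symbol X P' r ξ‖ ^ 2 = ∫ z : Ω' × Ω', (1 - Real.cos (2 * Real.pi * ξ *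
      (X r.toNNReal z.1 - X r.toNNReal z.2))) ∂(P'.prod P') := by
  have hm := hX.measurable r.toNNReal
  have h1 : ((‖symbol X P' r ξ‖ ^ 2 : ℝ) : ℂ) = symbol X P' r ξ * symbol X P' r (-ξ) := by
    rw [symbol_neg, Complex.mul_conj, Complex.normSq_eq_norm_sq]
  have h2 : symbol X P' r ξ * symbol X P' r (-ξ) = ∫ z : Ω' × Ω', Complex.exp ((-2 * Real.pi * ξ *
      (X r.toNNReal z.1 - X r.toNNReal z.2) : ℝ) * Complex.I) ∂(P'.prod P') := by
    rw [symbol_eq_integral hX, symbol_eq_integral hX, ← integral_prod_mul]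
    congr 1 with z
    rw [← Complex.exp_add]
    congr 1
    push_cast
    ring
  have hint : Integrable (fun z : Ω' × Ω' => Complex.exp ((-2 * Real.pi * ξ *
      (X r.toNNReal z.1 - X r.toNNReal z.2) : ℝ) * Complex.I)) (P'.prod P') := by
    refine Integrable.of_bound (C := 1) (Measurable.aestronglyMeasurable (by fun_prop)) ?_
    exact ae_of_all _ fun z => (Complex.norm_exp_ofReal_mul_I _).le
  have h3 : ‖symbol X P' r ξ‖ ^ 2 = ∫ z : Ω' × Ω', Real.cos (2 * Real.pi * ξ *
      (X r.toNNReal z.1 - X r.toNNReal z.2)) ∂(P'.prod P') := by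
    have := congrArg Complex.re (h1.trans h2)
    rw [Complex.ofReal_re, ← RCLike.re_eq_complex_re, ← integral_re hint] at this
    rw [this]
    congr 1 with z
    rw [RCLike.re_eq_complex_re, Complex.exp_ofReal_mul_I_re, ← Real.cos_neg]
    congr 1
    ring
  rw [integral_sub (integrable_const _), h3]
  · simp
  · refine Integrable.of_bound (C := 1) (Measurable.aestronglyMeasurable (by fun_prop)) ?_
    exact ae_of_all _ fun z => Real.abs_cos_le_one _

lemma one_sub_norm_symbol_sq_two_mul [IsProbabilityMeasure P'] (hX : IsLevyProcess X P')
    (r ξ : ℝ) :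
    1 - ‖symbol X P' r (2 * ξ)‖ ^ 2 ≤ 4 * (1 - ‖symbol X P' r ξ‖ ^ 2) := by
  have hm := hX.measurable r.toNNReal
  have hint : ∀ ξ : ℝ, Integrable (fun z : Ω' × Ω' => 1 - Real.cos (2 * Real.pi * ξ *
      (X r.toNNReal z.1 - X r.toNNReal z.2))) (P'.prod P') := fun ξ => by
    refine (integrable_const _).sub (Integrable.of_bound (C := 1)
      (Measurable.aestronglyMeasurable (by fun_prop)) ?_)
    exact ae_of_all _ fun z => Real.abs_cos_le_one _
  rw [one_sub_norm_symbol_sq hX, one_sub_norm_symbol_sq hX, ← integral_const_mul]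
  refine integral_mono (hint _) ((hint _).const_mul _) fun z => ?_
  set a := 2 * Real.pi * ξ * (X r.toNNReal z.1 - X r.toNNReal z.2) with ha
  have e : 2 * Real.pi * (2 * ξ) * (X r.toNNReal z.1 - X r.toNNReal z.2) = 2 * a := by
    rw [ha]; ring
  simp only [e, Real.cos_two_mul]
  nlinarith [sq_nonneg (Real.cos a - 1)]

/-- The doubling inequality for `1 - |symbol|² = 1 - exp(-rθ)` is divided by `r`; as `r → 0` it
becomes one for the exponent `θ`. -/
lemma exponent_two_mul_le [IsProbabilityMeasure P'] (hX : IsLevyProcess X P') (ξ : ℝ) :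
    exponent X P' (2 * ξ) ≤ 4 * exponent X P' ξ := by
  have hlim : ∀ θ : ℝ, Tendsto (fun r : ℝ => r⁻¹ * (1 - Real.exp (-(r * θ)))) (𝓝[>] 0) (𝓝 θ) := by
    intro θ
    have hd : HasDerivAt (fun r : ℝ => 1 - Real.exp (-(r * θ))) θ 0 := by
      have := (((hasDerivAt_id (0 : ℝ)).mul_const θ).neg.exp).const_sub 1
      simpa using this
    have := hd.tendsto_slope_zero_right
    simpa using this
  refine le_of_tendsto_of_tendsto (hlim _) ((hlim (exponent X P' ξ)).const_mul 4) ?_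
  filter_upwards [self_mem_nhdsWithin] with r hr
  have hr' : (0 : ℝ) < r := hr
  rw [← norm_symbol_sq hX hr'.le, ← norm_symbol_sq hX hr'.le]
  have := mul_le_mul_of_nonneg_left (one_sub_norm_symbol_sq_two_mul hX r ξ) (inv_pos.2 hr').le
  linarith

/-- Iterating the doubling inequality from the compact set `[-1, 1]` costs a factor `4` per dyadic
scale, which is quadratic growth. -/
lemma exists_exponent_le [IsProbabilityMeasure P'] (hX : IsLevyProcess X P') :
    ∃ C : ℝ, 0 < C ∧ ∀ ξ, exponent X P' ξ ≤ C * (1 + ξ ^ 2) := by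
  obtain ⟨C₀, hC₀⟩ := (isCompact_Icc (a := (-1 : ℝ)) (b := 1)).bddAbove_image
    (continuous_exponent hX).continuousOn
  set C := max C₀ 1 with hC
  have hCpos : 0 < C := by positivity
  have hbase : ∀ ξ : ℝ, |ξ| ≤ 1 → exponent X P' ξ ≤ C := fun ξ hξ =>
    (hC₀ ⟨ξ, abs_le.1 hξ, rfl⟩).trans (le_max_left _ _)
  have hstep : ∀ n : ℕ, ∀ ξ : ℝ, |ξ| ≤ 2 ^ n → exponent X P' ξ ≤ 4 ^ n * C := by
    intro n
    induction n with
    | zero => intro ξ hξ; simpa using hbase ξ (by simpa using hξ)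
    | succ k ih =>
      intro ξ hξ
      have h1 := exponent_two_mul_le hX (ξ / 2)
      have h2 := ih (ξ / 2) (by
        rw [abs_div, abs_two, div_le_iff₀ two_pos, ← pow_succ]; exact hξ)
      rw [mul_div_cancel₀ ξ two_ne_zero] at h1
      rw [pow_succ]
      linarith
  refine ⟨4 * C, by positivity, fun ξ => ?_⟩
  rcases le_or_gt |ξ| 1 with h | h
  · nlinarith [hbase ξ h, sq_nonneg ξ]
  · obtain ⟨n, hn1, hn2⟩ := exists_nat_pow_near h.le (one_lt_two (α := ℝ))
    refine (hstep (n + 1) ξ hn2.le).trans ?_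
    have : (4 : ℝ) ^ n ≤ ξ ^ 2 := by
      rw [← sq_abs, show (4 : ℝ) = 2 ^ 2 by norm_num, ← pow_mul, mul_comm, pow_mul]
      gcongr
    rw [pow_succ]
    nlinarith

/-- The energy density `k_t(ξ) = ∫₀ᵗ |E exp(-2π i ξ X_r)|² dr`. -/
def energy (X : ℝ≥0 → Ω' → ℝ) (P' : Measure Ω') (t ξ : ℝ) : ℝ :=
  ∫ r in (0 : ℝ)..t, ‖symbol X P' r ξ‖ ^ 2

/-- This bound lets the energy norm control a Sobolev norm of order `-1`. -/
lemma exists_le_energy [IsProbabilityMeasure P'] (hX : IsLevyProcess X P') {t : ℝ} (ht : 0 < t) :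
    ∃ c : ℝ, 0 < c ∧ ∀ ξ, c / (1 + ξ ^ 2) ≤ energy X P' t ξ := by
  obtain ⟨C, hC, hθ⟩ := exists_exponent_le hX
  refine ⟨t / (1 + t * C) * Real.exp (-1), by positivity, fun ξ => ?_⟩
  set θ := exponent X P' ξ with hθd
  have hθ0 : 0 ≤ θ := exponent_nonneg hX ξ
  -- Only times up to `τ` are used: `τ` is at most `t` and small enough that `τ θ ≤ 1`, so that the
  -- integrand stays above `exp (-1)`.
  set τ := t / (1 + t * C) / (1 + ξ ^ 2) with hτ
  have hτ0 : 0 ≤ τ := by positivity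
  have hτt : τ ≤ t := by
    rw [hτ, div_div]
    refine div_le_self ht.le ?_
    have := mul_pos ht hC
    nlinarith [sq_nonneg ξ]
  have hτθ : τ * θ ≤ 1 := by
    have h1 : τ * θ ≤ τ * (C * (1 + ξ ^ 2)) := by gcongr; exact hθ ξ
    have h2 : τ * (C * (1 + ξ ^ 2)) = t * C / (1 + t * C) := by
      rw [hτ]; field_simp
    have h3 : t * C / (1 + t * C) ≤ 1 := by
      rw [div_le_one (by positivity)]; linarith
    linarith
  have hcont : Continuous fun r => ‖symbol X P' r ξ‖ ^ 2 :=
    (continuous_symbol_time hX ξ).norm.pow 2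
  have h1 : ∫ r in (0 : ℝ)..τ, ‖symbol X P' r ξ‖ ^ 2 ≤ energy X P' t ξ :=
    intervalIntegral.integral_mono_interval le_rfl hτ0 hτt (ae_of_all _ fun r => by positivity)
      (hcont.intervalIntegrable _ _)
  have h2 : ∫ r in (0 : ℝ)..τ, Real.exp (-1) ≤ ∫ r in (0 : ℝ)..τ, ‖symbol X P' r ξ‖ ^ 2 := by
    refine intervalIntegral.integral_mono_on hτ0 (by simp) (hcont.intervalIntegrable _ _) ?_
    intro r hr
    rw [norm_symbol_sq hX hr.1]
    apply Real.exp_le_exp.2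
    have : r * θ ≤ τ * θ := by gcongr; exact hr.2
    linarith
  simp only [intervalIntegral.integral_const, sub_zero, smul_eq_mul] at h2
  calc _ = τ * Real.exp (-1) := by rw [hτ]; ring
    _ ≤ _ := h2.trans h1

end LevySymbol

/-! ### Plancherel's identity and convolution with a probability measure. -/

section Plancherel

/-- The Fourier integral of an integrable, square-integrable function represents its `L²` Fourier
transform. -/
lemma coeFn_fourier_toLp {f : ℝ → ℂ} (hf : Integrable f) (hf2 : MemLp f 2) :
    (𝓕 (hf2.toLp f) : Lp ℂ 2 (volume : Measure ℝ)) =ᵐ[volume] 𝓕 f := by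
  have hcont : Continuous (𝓕 f) := VectorFourier.fourierIntegral_continuous
    Real.continuous_fourierChar (L := innerₗ ℝ) continuous_inner hf
  refine ae_eq_of_integral_contDiff_smul_eq
    ((Lp.memLp _).locallyIntegrable (by norm_num)) hcont.locallyIntegrable fun g hg hgc => ?_
  have hgc' : HasCompactSupport (Complex.ofRealCLM ∘ g) := hgc.comp_left rfl
  have hg' : ContDiff ℝ (⊤ : ℕ∞) (Complex.ofRealCLM ∘ g) := Complex.ofRealCLM.contDiff.comp hg
  set G : 𝓢(ℝ, ℂ) := hgc'.toSchwartzMap hg' with hG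
  have hGg : ∀ x, G x = (g x : ℂ) := fun x => rfl
  have h1 := congrArg (fun T => T G) (Lp.fourier_toTemperedDistribution_eq (hf2.toLp f))
  simp only [TemperedDistribution.fourier_apply, Lp.toTemperedDistribution_apply] at h1
  calc ∫ x, g x • (𝓕 (hf2.toLp f) : Lp ℂ 2 (volume : Measure ℝ)) x
      = ∫ x, G x • (𝓕 (hf2.toLp f) : Lp ℂ 2 (volume : Measure ℝ)) x := by
        simp [hGg]
    _ = ∫ x, 𝓕 G x • (hf2.toLp f) x := h1.symm
    _ = ∫ x, 𝓕 G x • f x := by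
        refine integral_congr_ae ?_
        filter_upwards [hf2.coeFn_toLp] with x hx
        rw [hx]
    _ = ∫ x, G x • 𝓕 f x := by
        simpa using! VectorFourier.integral_fourierIntegral_smul_eq_flip (L := innerₗ ℝ)
          Real.continuous_fourierChar continuous_inner G.integrable hf
    _ = ∫ x, g x • 𝓕 f x := by simp [hGg]

lemma eLpNorm_fourier {f : ℝ → ℂ} (hf : Integrable f) (hf2 : MemLp f 2) :
    eLpNorm (𝓕 f) 2 volume = eLpNorm f 2 volume := by
  rw [← eLpNorm_congr_ae (coeFn_fourier_toLp hf hf2), ← eLpNorm_congr_ae hf2.coeFn_toLp]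
  have := Lp.norm_fourier_eq (hf2.toLp f)
  rw [Lp.norm_def, Lp.norm_def] at this
  exact (ENNReal.toReal_eq_toReal_iff' (Lp.eLpNorm_ne_top _) (Lp.eLpNorm_ne_top _)).1 this

lemma lintegral_fourier_sq {f : ℝ → ℂ} (hf : Integrable f) (hf2 : MemLp f 2) :
    ∫⁻ ξ, ‖𝓕 f ξ‖ₑ ^ 2 = ∫⁻ x, ‖f x‖ₑ ^ 2 := by
  have h := eLpNorm_fourier hf hf2
  have e : ∀ g : ℝ → ℂ, ∫⁻ x, ‖g x‖ₑ ^ 2 = eLpNorm g 2 volume ^ 2 := fun g => by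
    have := eLpNorm_nnreal_pow_eq_lintegral (f := g) (μ := volume) (p := 2) (by norm_num)
    simpa using this.symm
  rw [e, e, h]

variable {μ : Measure ℝ} [IsProbabilityMeasure μ] {f : ℝ → ℂ}

lemma integrable_comp_sub_prod (hf : Integrable f) (hfc : Continuous f) :
    Integrable (fun z : ℝ × ℝ => f (z.2 - z.1)) (μ.prod volume) := by
  rw [integrable_prod_iff (by fun_prop)]
  refine ⟨ae_of_all _ fun z => hf.comp_sub_right z, ?_⟩
  have : ∀ z : ℝ, ∫ y, ‖f (y - z)‖ = ∫ y, ‖f y‖ := fun z =>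
    integral_sub_right_eq_self (fun y => ‖f y‖) z
  simp only [this]
  exact integrable_const _

lemma integrable_integral_comp_sub (hf : Integrable f) (hfc : Continuous f) :
    Integrable (fun y => ∫ z, f (y - z) ∂μ) :=
  (integrable_comp_sub_prod hf hfc).integral_prod_right

lemma memLp_two_integral_comp_sub (hf : Integrable f) (hfc : Continuous f) {C : ℝ}
    (hC : ∀ x, ‖f x‖ ≤ C) : MemLp (fun y => ∫ z, f (y - z) ∂μ) 2 := by
  have hi := integrable_integral_comp_sub (μ := μ) hf hfc
  rw [memLp_two_iff_integrable_sq_norm hi.aestronglyMeasurable]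
  refine (hi.norm.const_mul C).mono' (hi.aestronglyMeasurable.norm.pow 2) (ae_of_all _ fun y => ?_)
  have hb : ‖∫ z, f (y - z) ∂μ‖ ≤ C := by
    have := norm_integral_le_of_norm_le_const (μ := μ) (ae_of_all _ fun z => hC (y - z))
    simpa using this
  rw [Real.norm_of_nonneg (by positivity), sq]
  gcongr

lemma fourier_integral_comp_sub (hf : Integrable f) (hfc : Continuous f) (ξ : ℝ) :
    𝓕 (fun y => ∫ z, f (y - z) ∂μ) ξ = 𝓕 f ξ * charFun μ (-2 * Real.pi * ξ) := by
  have hint := integrable_comp_sub_prod (μ := μ) hf hfc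
  have h2 : Integrable (fun z : ℝ × ℝ => Complex.exp ((-2 * Real.pi * z.2 * ξ : ℝ) * Complex.I)
      * f (z.2 - z.1)) (μ.prod volume) := by
    refine hint.bdd_mul (c := 1) (by fun_prop) (ae_of_all _ fun z => ?_)
    exact (Complex.norm_exp_ofReal_mul_I _).le
  rw [Real.fourier_real_eq_integral_exp_smul, Real.fourier_real_eq_integral_exp_smul,
    charFun_apply_real, ← integral_const_mul]
  simp_rw [smul_eq_mul, ← integral_const_mul]
  rw [integral_integral_swap (by exact h2.swap)]
  congr 1 with z
  have := integral_sub_right_eq_self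
    (fun y => Complex.exp ((-2 * Real.pi * (y + z) * ξ : ℝ) * Complex.I) * f y) z (μ := volume)
  simp only [sub_add_cancel] at this
  rw [this, ← integral_mul_const]
  congr 1 with y
  rw [mul_right_comm (Complex.exp _), ← Complex.exp_add]
  congr 2
  push_cast
  ring

end Plancherel

/-! ### Identification of the point mass in a negative Sobolev space. -/

section Dirac

/-- The character `ξ ↦ exp(-2π i ξ x)`, which is the Fourier transform of `δₓ`. -/
def diracFourier (x ξ : ℝ) : ℂ := Complex.exp ((-2 * Real.pi * ξ * x : ℝ) * Complex.I)

lemma norm_diracFourier (x ξ : ℝ) : ‖diracFourier x ξ‖ = 1 := Complex.norm_exp_ofReal_mul_I _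

@[fun_prop]
lemma continuous_diracFourier : Continuous fun z : ℝ × ℝ => diracFourier z.1 z.2 := by
  unfold diracFourier
  fun_prop

/-- The complexification of a real Schwartz function. -/
def complexify (φ : 𝓢(ℝ, ℝ)) : 𝓢(ℝ, ℂ) := φ.postcompCLM Complex.ofRealCLM

@[simp]
lemma complexify_apply (φ : 𝓢(ℝ, ℝ)) (x : ℝ) : complexify φ x = (φ x : ℂ) := rfl

lemma TendstoDirac.tendsto_complex {φ : ℕ → 𝓢(ℝ, ℝ)} {x : ℝ} (hφ : TendstoDirac φ x)
    (ψ : 𝓢(ℝ, ℂ)) (hψ : HasCompactSupport ψ) :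
    Tendsto (fun n => ∫ y, complexify (φ n) y * ψ y) atTop (𝓝 (ψ x)) := by
  have hre := hφ (fun y => (ψ y).re) (Complex.reCLM.contDiff.comp (ψ.smooth ⊤))
    (hψ.comp_left (g := Complex.re) rfl)
  have him := hφ (fun y => (ψ y).im) (Complex.imCLM.contDiff.comp (ψ.smooth ⊤))
    (hψ.comp_left (g := Complex.im) rfl)
  have h := ((Complex.continuous_ofReal.tendsto _).comp hre).add
    (((Complex.continuous_ofReal.tendsto _).comp him).mul_const Complex.I)
  rw [Complex.re_add_im] at h
  refine h.congr fun n => ?_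
  have hint : Integrable fun y => complexify (φ n) y * ψ y := by
    refine ψ.integrable.bdd_mul (c := ‖(complexify (φ n)).toBoundedContinuousFunction‖)
      (complexify (φ n)).continuous.aestronglyMeasurable (ae_of_all _ fun y => ?_)
    exact (complexify (φ n)).toBoundedContinuousFunction.norm_coe_le_norm y
  rw [← integral_re_add_im hint]
  simp

lemma norm_one_add_two_pi_mul (ξ : ℝ) :
    ‖(1 + 2 * Real.pi * ξ * Complex.I : ℂ)‖ ^ 2 = 1 + (2 * Real.pi * ξ) ^ 2 := by
  have : (1 + 2 * Real.pi * ξ * Complex.I : ℂ) = (1 : ℝ) + (2 * Real.pi * ξ : ℝ) * Complex.I := by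
    push_cast; ring
  rw [← Complex.normSq_eq_norm_sq, this, Complex.normSq_add_mul_I]
  ring

lemma one_add_two_pi_mul_ne_zero (ξ : ℝ) : (1 + 2 * Real.pi * ξ * Complex.I : ℂ) ≠ 0 := by
  intro h
  have := norm_one_add_two_pi_mul ξ
  rw [h, norm_zero] at this
  nlinarith [sq_nonneg (2 * Real.pi * ξ)]

/-- Multiplication by `1 + 2πiξ` corresponds to `1 - ∂` on the test function. Pairing a transform
divided by this factor with `𝓕⁻ (ψ - ψ')` is therefore the same as pairing the undivided transform
with `𝓕⁻ ψ`. -/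
lemma fourierInv_sub_deriv (ψ : 𝓢(ℝ, ℂ)) (ξ : ℝ) :
    𝓕⁻ (ψ - ∂_{(1 : ℝ)} ψ) ξ = (1 + 2 * Real.pi * ξ * Complex.I) * 𝓕⁻ ψ ξ := by
  have : (inner ℝ · (1 : ℝ) : ℝ → ℝ).HasTemperateGrowth := by fun_prop
  have hsub : 𝓕⁻ (ψ - ∂_{(1 : ℝ)} ψ) = 𝓕⁻ ψ - 𝓕⁻ (∂_{(1 : ℝ)} ψ) :=
    map_sub (FourierTransform.fourierInvCLM ℂ 𝓢(ℝ, ℂ)) _ _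
  rw [hsub, SchwartzMap.fourierInv_lineDerivOp_eq]
  rw [sub_apply, smul_apply, SchwartzMap.smulLeftCLM_apply_apply this]
  simp
  ring

/-- Smooth compactly supported test functions suffice to detect the vanishing of the
first-order expression `U + U'` of a square-integrable function `U`. -/
lemma integral_mul_sub_deriv_eq_zero (U : Lp ℂ 2 (volume : Measure ℝ))
    (hU : ∀ ψ : 𝓢(ℝ, ℂ), HasCompactSupport ψ → ∫ x, (ψ - ∂_{(1 : ℝ)} ψ) x * U x = 0)
    (ψ : 𝓢(ℝ, ℂ)) : ∫ x, (ψ - ∂_{(1 : ℝ)} ψ) x * U x = 0 := by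
  let η : ContDiffBump (0 : ℝ) := ⟨1, 2, one_pos, one_lt_two⟩
  have hηd : ContDiff ℝ (⊤ : ℕ∞) (η : ℝ → ℝ) := η.contDiff
  obtain ⟨D, hD⟩ : ∃ D, ∀ x, ‖deriv η x‖ ≤ D :=
    (η.hasCompactSupport.deriv).exists_bound_of_continuous
      (hηd.continuous_deriv (by exact_mod_cast le_top))
  -- Cutoffs equal to `1` on growing intervals, with derivative `O(1 / (n + 1))`. The commutator of
  -- `1 - ∂` with the cutoff thus vanishes in the limit, by dominated convergence.
  let θ : ℕ → ℝ → ℝ := fun n x => η ((n + 1 : ℝ)⁻¹ * x)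
  have hθd : ∀ n x, HasDerivAt (θ n) ((n + 1 : ℝ)⁻¹ * deriv η ((n + 1 : ℝ)⁻¹ * x)) x := by
    intro n x
    have h1 : HasDerivAt η (deriv η ((n + 1 : ℝ)⁻¹ * x)) ((n + 1 : ℝ)⁻¹ * x) :=
      (hηd.differentiable (by simp)).differentiableAt.hasDerivAt
    have h2 : HasDerivAt (fun x : ℝ => (n + 1 : ℝ)⁻¹ * x) ((n + 1 : ℝ)⁻¹ * 1) x :=
      (hasDerivAt_id x).const_mul _
    have := h1.comp x h2
    rw [mul_one, mul_comm] at this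
    exact this
  have hpos : ∀ n : ℕ, (0 : ℝ) < (n + 1 : ℝ)⁻¹ := fun n => by positivity
  have hθc : ∀ n, HasCompactSupport (θ n) := fun n =>
    η.hasCompactSupport.comp_homeomorph (Homeomorph.mulLeft₀ _ (hpos n).ne')
  have hθs : ∀ n, ContDiff ℝ (⊤ : ℕ∞) (θ n) := fun n => hηd.comp (contDiff_const.mul contDiff_id)
  have hc : ∀ n, HasCompactSupport fun x => (θ n x : ℂ) * ψ x := fun n =>
    ((hθc n).comp_left (g := ((↑) : ℝ → ℂ)) rfl).mul_right
  have hs : ∀ n, ContDiff ℝ (⊤ : ℕ∞) fun x => (θ n x : ℂ) * ψ x := fun n =>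
    (Complex.ofRealCLM.contDiff.comp (hθs n)).mul (ψ.smooth ⊤)
  let Ψ : ℕ → 𝓢(ℝ, ℂ) := fun n => (hc n).toSchwartzMap (hs n)
  have hder : ∀ (χ : 𝓢(ℝ, ℂ)) x, (∂_{(1 : ℝ)} χ) x = deriv χ x := fun χ x => by
    rw [SchwartzMap.lineDerivOp_apply_eq_fderiv]; simp
  have hval : ∀ n x, (Ψ n - ∂_{(1 : ℝ)} (Ψ n)) x = θ n x * (ψ - ∂_{(1 : ℝ)} ψ) x
      - ((n + 1 : ℝ)⁻¹ * deriv η ((n + 1 : ℝ)⁻¹ * x) : ℝ) * ψ x := by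
    intro n x
    have h1 : HasDerivAt (Ψ n) (((n + 1 : ℝ)⁻¹ * deriv η ((n + 1 : ℝ)⁻¹ * x) : ℝ) * ψ x
        + θ n x * deriv ψ x) x :=
      (hθd n x).ofReal_comp.mul ψ.differentiableAt.hasDerivAt
    simp only [sub_apply, hder]
    rw [h1.deriv]
    change (θ n x : ℂ) * ψ x - _ = _
    ring
  have hzero : ∀ n, ∫ x, (Ψ n - ∂_{(1 : ℝ)} (Ψ n)) x * U x = 0 := fun n => hU (Ψ n) (hc n)
  have hprod : ∀ χ : 𝓢(ℝ, ℂ), Integrable fun x => ‖χ x‖ * ‖U x‖ := fun χ =>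
    (χ.memLp 2).norm.integrable_mul (Lp.memLp U).norm
  have hinv : ∀ n : ℕ, (n + 1 : ℝ)⁻¹ ≤ 1 := fun n =>
    inv_le_one_of_one_le₀ (by linarith [(Nat.cast_nonneg n : (0 : ℝ) ≤ n)])
  have hlim0 : Tendsto (fun n : ℕ => (n + 1 : ℝ)⁻¹) atTop (𝓝 0) :=
    tendsto_one_div_add_atTop_nhds_zero_nat.congr fun n => one_div _
  have hlim : Tendsto (fun n => ∫ x, (Ψ n - ∂_{(1 : ℝ)} (Ψ n)) x * U x) atTop
      (𝓝 (∫ x, (ψ - ∂_{(1 : ℝ)} ψ) x * U x)) := by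
    refine tendsto_integral_of_dominated_convergence
      (fun x => ‖(ψ - ∂_{(1 : ℝ)} ψ) x‖ * ‖U x‖ + D * (‖ψ x‖ * ‖U x‖)) (fun n => ?_)
      ((hprod _).add ((hprod ψ).const_mul D)) (fun n => ae_of_all _ fun x => ?_)
      (ae_of_all _ fun x => ?_)
    · exact (SchwartzMap.continuous _).aestronglyMeasurable.mul (Lp.aestronglyMeasurable U)
    · rw [hval, norm_mul]
      have hD0 : 0 ≤ D := (norm_nonneg _).trans (hD 0)
      have h1 : ‖(θ n x : ℂ)‖ ≤ 1 := by
        rw [Complex.norm_real, Real.norm_of_nonneg η.nonneg]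
        exact η.le_one
      have h2 : ‖(((n + 1 : ℝ)⁻¹ * deriv η ((n + 1 : ℝ)⁻¹ * x) : ℝ) : ℂ)‖ ≤ D := by
        rw [Complex.norm_real, norm_mul, Real.norm_of_nonneg (hpos n).le]
        calc _ ≤ 1 * D := mul_le_mul (hinv n) (hD _) (norm_nonneg _) zero_le_one
          _ = D := one_mul D
      calc _ ≤ (‖(θ n x : ℂ) * (ψ - ∂_{(1 : ℝ)} ψ) x‖ + ‖(((n + 1 : ℝ)⁻¹ * deriv η ((n + 1 : ℝ)⁻¹ * x) : ℝ) : ℂ) * ψ x‖) * ‖U x‖ := by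
            gcongr; exact norm_sub_le _ _
        _ ≤ (1 * ‖(ψ - ∂_{(1 : ℝ)} ψ) x‖ + D * ‖ψ x‖) * ‖U x‖ := by
            rw [norm_mul, norm_mul]; gcongr
        _ = _ := by ring
    · simp only [hval]
      refine Tendsto.mul_const _ ?_
      have e1 : Tendsto (fun n => (θ n x : ℂ)) atTop (𝓝 1) := by
        have : Tendsto (fun n : ℕ => (n + 1 : ℝ)⁻¹ * x) atTop (𝓝 0) := by
          simpa using hlim0.mul_const x
        have h3 := (Complex.continuous_ofReal.tendsto _).comp ((hηd.continuous.tendsto 0).comp this)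
        rw [η.one_of_mem_closedBall (Metric.mem_closedBall_self zero_le_one)] at h3
        simpa [Function.comp_def, θ] using h3
      have e2 : Tendsto (fun n : ℕ => (((n + 1 : ℝ)⁻¹ * deriv η ((n + 1 : ℝ)⁻¹ * x) : ℝ) : ℂ))
          atTop (𝓝 0) := by
        rw [← Complex.ofReal_zero]
        refine (Complex.continuous_ofReal.tendsto _).comp ?_
        refine squeeze_zero_norm (a := fun n : ℕ => (n + 1 : ℝ)⁻¹ * D) (fun n => ?_) (by
          simpa using hlim0.mul_const D)
        rw [norm_mul, Real.norm_of_nonneg (hpos n).le]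
        gcongr
        exact hD _
      simpa using (e1.mul_const ((ψ - ∂_{(1 : ℝ)} ψ) x)).sub (e2.mul_const (ψ x))
  simp only [hzero] at hlim
  exact (tendsto_nhds_unique tendsto_const_nhds hlim).symm

lemma memLp_diracFourier_div (x : ℝ) :
    MemLp (fun ξ => diracFourier x ξ / (1 + 2 * Real.pi * ξ * Complex.I)) 2 volume := by
  have hm : AEStronglyMeasurable
      (fun ξ : ℝ => diracFourier x ξ / (1 + 2 * Real.pi * ξ * Complex.I)) volume :=
    Continuous.aestronglyMeasurable (((continuous_diracFourier.comp (by fun_prop :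
      Continuous fun ξ : ℝ => (x, ξ)))).div (by fun_prop) one_add_two_pi_mul_ne_zero)
  rw [memLp_two_iff_integrable_sq_norm hm]
  have : ∀ ξ : ℝ, ‖diracFourier x ξ / (1 + 2 * Real.pi * ξ * Complex.I)‖ ^ 2
      = (1 + (2 * Real.pi * ξ) ^ 2)⁻¹ := fun ξ => by
    rw [norm_div, norm_diracFourier, div_pow, norm_one_add_two_pi_mul, one_pow, one_div]
  simp only [this]
  exact integrable_inv_one_add_sq.comp_mul_left' (by positivity)

/-- If the Fourier transforms of `φₙ → δₓ` converge in the weighted `L²` space with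
weight `(1 + 4π²ξ²)⁻¹`, then the limit is the Fourier transform of `δₓ`. -/
lemma TendstoDirac.ae_eq_of_tendsto {φ : ℕ → 𝓢(ℝ, ℝ)} {x : ℝ} (hφ : TendstoDirac φ x)
    {V : ℕ → Lp ℂ 2 (volume : Measure ℝ)} {V₀ : Lp ℂ 2 (volume : Measure ℝ)}
    (hV : ∀ n, V n =ᵐ[volume]
      fun ξ => 𝓕 (complexify (φ n)) ξ / (1 + 2 * Real.pi * ξ * Complex.I))
    (hlim : Tendsto V atTop (𝓝 V₀)) :
    V₀ =ᵐ[volume] fun ξ => diracFourier x ξ / (1 + 2 * Real.pi * ξ * Complex.I) := by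
  have hE := memLp_diracFourier_div x
  set E := hE.toLp _ with hEdef
  -- Both `V₀` and the expected limit `E` pair with `𝓕⁻ (ψ - ψ')` to give `ψ x`; the support of `ψ`
  -- must be compact because `TendstoDirac` tests nothing else.
  have key : ∀ ψ : 𝓢(ℝ, ℂ), HasCompactSupport ψ →
      ∫ ξ, 𝓕⁻ (ψ - ∂_{(1 : ℝ)} ψ) ξ • (V₀ - E) ξ = 0 := by
    intro ψ hψ
    set Θ := 𝓕⁻ (ψ - ∂_{(1 : ℝ)} ψ) with hΘ
    have h1 : Tendsto (fun n => Lp.toTemperedDistribution (V n) Θ) atTop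
        (𝓝 (Lp.toTemperedDistribution V₀ Θ)) :=
      (((PointwiseConvergenceCLM.evalCLM _ ℂ Θ).continuous.comp
        (Lp.toTemperedDistributionCLM ℂ volume 2).continuous).tendsto V₀).comp hlim
    have h2 : ∀ n, Lp.toTemperedDistribution (V n) Θ = ∫ y, complexify (φ n) y * ψ y := by
      intro n
      rw [Lp.toTemperedDistribution_apply]
      have := SchwartzMap.integral_fourier_mul_eq (complexify (φ n)) (𝓕⁻ ψ)
      rw [FourierTransform.fourier_fourierInv_eq] at this
      rw [← this]
      refine integral_congr_ae ?_
      filter_upwards [hV n] with ξ hξ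
      rw [hξ, hΘ, fourierInv_sub_deriv, smul_eq_mul]
      field_simp [one_add_two_pi_mul_ne_zero ξ]
    have h3 : Lp.toTemperedDistribution V₀ Θ = ψ x := by
      simp only [h2] at h1
      exact tendsto_nhds_unique h1 (hφ.tendsto_complex ψ hψ)
    have h4 : Lp.toTemperedDistribution E Θ = ψ x := by
      rw [Lp.toTemperedDistribution_apply]
      have : ψ x = 𝓕 (𝓕⁻ ψ) x := by rw [FourierTransform.fourier_fourierInv_eq]
      rw [this, SchwartzMap.fourier_coe, Real.fourier_real_eq_integral_exp_smul]
      refine integral_congr_ae ?_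
      filter_upwards [hE.coeFn_toLp] with ξ hξ
      rw [hξ, hΘ, fourierInv_sub_deriv, smul_eq_mul, smul_eq_mul, diracFourier]
      field_simp [one_add_two_pi_mul_ne_zero ξ]
    have h5 : Lp.toTemperedDistribution (V₀ - E) Θ = 0 := by
      have := congrArg (fun T => T Θ) (map_sub (Lp.toTemperedDistributionCLM ℂ volume 2) V₀ E)
      simp only [Lp.toTemperedDistributionCLM_apply] at this
      rw [this]
      change Lp.toTemperedDistribution V₀ Θ - Lp.toTemperedDistribution E Θ = 0
      rw [h3, h4, sub_self]
    rwa [Lp.toTemperedDistribution_apply] at h5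
  set W := V₀ - E with hW
  have hswap : ∀ χ : 𝓢(ℝ, ℂ), ∫ ξ, 𝓕⁻ χ ξ • W ξ
      = ∫ y, χ y * (𝓕⁻ W : Lp ℂ 2 (volume : Measure ℝ)) y := by
    intro χ
    have h := congrArg (fun T => T χ) (Lp.fourierInv_toTemperedDistribution_eq W)
    simpa only [TemperedDistribution.fourierInv_apply, Lp.toTemperedDistribution_apply,
      smul_eq_mul] using h
  -- On the physical side `𝓕⁻ W` is square integrable, so the cutoff argument removes the support
  -- restriction. Test functions with compact support in frequency then become available.
  have hall : ∀ ψ : 𝓢(ℝ, ℂ), ∫ ξ, 𝓕⁻ (ψ - ∂_{(1 : ℝ)} ψ) ξ • W ξ = 0 := by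
    intro ψ
    rw [hswap]
    exact integral_mul_sub_deriv_eq_zero _ (fun χ hχ => by rw [← hswap]; exact key χ hχ) ψ
  have hW0 : ∀ᵐ ξ : ℝ, (1 + 2 * Real.pi * ξ * Complex.I : ℂ) * W ξ = 0 := by
    refine ae_eq_zero_of_integral_contDiff_smul_eq_zero ?_ fun g hg hgc => ?_
    · have := ((Lp.memLp W).locallyIntegrable (by norm_num)).continuous_mul
        (g := fun ξ : ℝ => (1 + 2 * Real.pi * ξ * Complex.I : ℂ)) (by fun_prop)
      exact this
    · have hgc' : HasCompactSupport (Complex.ofRealCLM ∘ g) := hgc.comp_left rfl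
      have hg' : ContDiff ℝ (⊤ : ℕ∞) (Complex.ofRealCLM ∘ g) := Complex.ofRealCLM.contDiff.comp hg
      set G : 𝓢(ℝ, ℂ) := hgc'.toSchwartzMap hg' with hG
      have hGg : ∀ x, G x = (g x : ℂ) := fun x => rfl
      rw [← hall (𝓕 G)]
      congr 1 with ξ
      rw [fourierInv_sub_deriv, FourierTransform.fourierInv_fourier_eq, hGg]
      simp only [Complex.real_smul, smul_eq_mul]
      ring
  filter_upwards [hW0, hE.coeFn_toLp, Lp.coeFn_sub V₀ E] with ξ h1 h2 h3
  have h4 := (mul_eq_zero.1 h1).resolve_left (one_add_two_pi_mul_ne_zero ξ)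
  rw [hW, h3, Pi.sub_apply, sub_eq_zero] at h4
  rw [h4, h2]

end Dirac

/-! ### Wiener kernels in frequency variables and the energy space. -/

section Kernels

variable {Ω' : Type*} [MeasurableSpace Ω'] {X : ℝ≥0 → Ω' → ℝ} {P' : Measure Ω'}

lemma eLpNorm_two_sq {α E : Type*} [MeasurableSpace α] [NormedAddCommGroup E] (f : α → E)
    (μ : Measure α) : eLpNorm f 2 μ ^ 2 = ∫⁻ x, ‖f x‖ₑ ^ 2 ∂μ := by
  have := eLpNorm_nnreal_pow_eq_lintegral (f := f) (μ := μ) (p := 2) (by norm_num)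
  simpa using this

lemma eLpNorm_two_eq_of_lintegral_eq {α β E F : Type*} [MeasurableSpace α] [MeasurableSpace β]
    [NormedAddCommGroup E] [NormedAddCommGroup F] {f : α → E} {g : β → F} {μ : Measure α}
    {ν : Measure β} (h : ∫⁻ x, ‖f x‖ₑ ^ 2 ∂μ = ∫⁻ x, ‖g x‖ₑ ^ 2 ∂ν) :
    eLpNorm f 2 μ = eLpNorm g 2 ν := by
  rw [← eLpNorm_two_sq, ← eLpNorm_two_sq] at h
  exact (ENNReal.pow_right_strictMono two_ne_zero).injective h

lemma spaceTimeMeasure_eq_prod :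
    spaceTimeMeasure = (volume.restrict (Set.Ici (0 : ℝ))).prod (volume : Measure ℝ) := by
  rw [spaceTimeMeasure, spaceTime, Measure.volume_eq_prod, ← Measure.prod_restrict,
    Measure.restrict_univ]

/-- The Fourier transform of a real test function. -/
abbrev testFourier (φ : 𝓢(ℝ, ℝ)) : 𝓢(ℝ, ℂ) := 𝓕 (complexify φ)

/-- The integrand of the Wiener integral which defines the weak solution. -/
def weakKernel (X : ℝ≥0 → Ω' → ℝ) (P' : Measure Ω') (t : ℝ) (φ : 𝓢(ℝ, ℝ)) (z : ℝ × ℝ) : ℝ :=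
  if z.1 ≤ t then dualSemigroup X P' (t - z.1) (fun x => φ x) z.2 else 0

/-- The spatial Fourier transform of `weakKernel`, with `g` in the place of the Fourier transform
of the test function. -/
def freqKernel (X : ℝ≥0 → Ω' → ℝ) (P' : Measure Ω') (t : ℝ) (g : ℝ → ℂ) (z : ℝ × ℝ) : ℂ :=
  if z.1 ≤ t then g z.2 * symbol X P' (t - z.1) z.2 else 0

lemma dualSemigroup_eq_integral_law (hX : IsLevyProcess X P') (φ : 𝓢(ℝ, ℝ)) (r y : ℝ) :
    dualSemigroup X P' r (fun x => φ x) y = ∫ z, φ (y - z) ∂(P'.map (X r.toNNReal)) := by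
  rw [dualSemigroup, integral_map (hX.measurable _).aemeasurable
    (by have := φ.continuous; fun_prop)]

lemma exists_bound (φ : 𝓢(ℝ, ℝ)) : ∃ C, ∀ x, ‖φ x‖ ≤ C :=
  ⟨‖φ.toBoundedContinuousFunction‖, fun x => φ.toBoundedContinuousFunction.norm_coe_le_norm x⟩

lemma measurable_dualSemigroup [IsProbabilityMeasure P'] (hX : IsLevyProcess X P')
    (φ : 𝓢(ℝ, ℝ)) :
    Measurable fun z : ℝ × ℝ => dualSemigroup X P' z.1 (fun x => φ x) z.2 := by
  obtain ⟨C, hC⟩ := exists_bound φ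
  refine Measurable.comp (g := fun z : ℝ × ℝ => dualSemigroup X P' z.2 (fun x => φ x) z.1)
    (f := Prod.swap) (measurable_uncurry_of_continuous_of_measurable
    (u := fun r y => dualSemigroup X P' y (fun x => φ x) r) (fun y => ?_) (fun r => ?_))
    measurable_swap
  · refine continuous_of_dominated (bound := fun _ => C) (fun r => ?_)
      (fun r => ae_of_all _ fun ω => hC _) (integrable_const _)
      (ae_of_all _ fun ω => by have := φ.continuous; fun_prop)
    have := hX.measurable y.toNNReal
    exact (φ.continuous.measurable.comp (measurable_const.sub this)).aestronglyMeasurable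
  · exact ((hX.continuous_integral_comp (f := fun x => φ (r - x))
      (by have := φ.continuous; fun_prop) fun x => hC _).comp
      continuous_real_toNNReal).measurable

lemma measurable_weakKernel [IsProbabilityMeasure P'] (hX : IsLevyProcess X P') (t : ℝ)
    (φ : 𝓢(ℝ, ℝ)) : Measurable (weakKernel X P' t φ) :=
  Measurable.ite (measurableSet_le measurable_fst measurable_const)
    ((measurable_dualSemigroup hX φ).comp (by fun_prop :
      Measurable fun z : ℝ × ℝ => (t - z.1, z.2))) measurable_const

lemma measurable_freqKernel [IsProbabilityMeasure P'] (hX : IsLevyProcess X P') (t : ℝ)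
    {g : ℝ → ℂ} (hg : Measurable g) : Measurable (freqKernel X P' t g) :=
  Measurable.ite (measurableSet_le measurable_fst measurable_const)
    ((hg.comp measurable_snd).mul ((measurable_symbol hX).comp (by fun_prop :
      Measurable fun z : ℝ × ℝ => (t - z.1, z.2)))) measurable_const

lemma weakKernel_section [IsProbabilityMeasure P'] (hX : IsLevyProcess X P') (t s : ℝ)
    (φ : 𝓢(ℝ, ℝ)) :
    Integrable (fun y => (weakKernel X P' t φ (s, y) : ℂ)) ∧
    MemLp (fun y => (weakKernel X P' t φ (s, y) : ℂ)) 2 ∧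
    ∀ ξ, 𝓕 (fun y => (weakKernel X P' t φ (s, y) : ℂ)) ξ
      = freqKernel X P' t (testFourier φ) (s, ξ) := by
  by_cases h : s ≤ t
  · have := isProbabilityMeasure_law hX (t - s).toNNReal
    have e : (fun y => (weakKernel X P' t φ (s, y) : ℂ))
        = fun y => ∫ z, complexify φ (y - z) ∂(P'.map (X (t - s).toNNReal)) := by
      ext y
      rw [weakKernel, if_pos h, dualSemigroup_eq_integral_law hX, ← integral_complex_ofReal]
      rfl
    have hb : ∀ x, ‖complexify φ x‖ ≤ ‖(complexify φ).toBoundedContinuousFunction‖ :=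
      fun x => (complexify φ).toBoundedContinuousFunction.norm_coe_le_norm x
    rw [e]
    refine ⟨integrable_integral_comp_sub (complexify φ).integrable (complexify φ).continuous,
      memLp_two_integral_comp_sub (complexify φ).integrable (complexify φ).continuous hb,
      fun ξ => ?_⟩
    rw [fourier_integral_comp_sub (complexify φ).integrable (complexify φ).continuous,
      freqKernel, if_pos h]
    rfl
  · have e : (fun y => (weakKernel X P' t φ (s, y) : ℂ)) = 0 := by
      ext y
      simp [weakKernel, h]
    rw [e]
    refine ⟨integrable_zero _ _ _, MemLp.zero, fun ξ => ?_⟩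
    simp [freqKernel, h, Real.fourier_eq]

/-- Plancherel on each time slice. Two different times are allowed because continuity of the field
in `(t, x)` compares kernels at different times. -/
lemma eLpNorm_weakKernel_sub [IsProbabilityMeasure P'] (hX : IsLevyProcess X P') (t t' : ℝ)
    (φ φ' : 𝓢(ℝ, ℝ)) :
    eLpNorm (fun z => weakKernel X P' t φ z - weakKernel X P' t' φ' z) 2 spaceTimeMeasure
      = eLpNorm (fun z => freqKernel X P' t (testFourier φ) z
        - freqKernel X P' t' (testFourier φ') z) 2 spaceTimeMeasure := by
  apply eLpNorm_two_eq_of_lintegral_eq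
  have hm := (testFourier φ).continuous.measurable
  have hm' := (testFourier φ').continuous.measurable
  have m1 : Measurable fun z => ‖weakKernel X P' t φ z - weakKernel X P' t' φ' z‖ₑ ^ 2 :=
    (((measurable_weakKernel hX t φ).sub (measurable_weakKernel hX t' φ')).enorm).pow_const 2
  have m2 : Measurable fun z => ‖freqKernel X P' t (testFourier φ) z
      - freqKernel X P' t' (testFourier φ') z‖ₑ ^ 2 :=
    (((measurable_freqKernel hX t hm).sub (measurable_freqKernel hX t' hm')).enorm).pow_const 2
  rw [spaceTimeMeasure_eq_prod, lintegral_prod _ m1.aemeasurable, lintegral_prod _ m2.aemeasurable]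
  congr 1 with s
  obtain ⟨i1, l1, f1⟩ := weakKernel_section hX t s φ
  obtain ⟨i2, l2, f2⟩ := weakKernel_section hX t' s φ'
  have h := lintegral_fourier_sq (i1.sub i2) (l1.sub l2)
  have e : ∀ ξ, 𝓕 ((fun y => (weakKernel X P' t φ (s, y) : ℂ))
      - fun y => (weakKernel X P' t' φ' (s, y) : ℂ)) ξ
      = freqKernel X P' t (testFourier φ) (s, ξ)
        - freqKernel X P' t' (testFourier φ') (s, ξ) := by
    intro ξ
    rw [← f1, ← f2, sub_eq_add_neg, sub_eq_add_neg]
    simp only [Real.fourier_real_eq_integral_exp_smul, Pi.add_apply, Pi.neg_apply, smul_add,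
      smul_neg]
    rw [integral_add, integral_neg]
    · exact i1.bdd_mul (c := 1)
        (f := fun v : ℝ => Complex.exp ((-2 * Real.pi * v * ξ : ℝ) * Complex.I))
          (by fun_prop) (ae_of_all _ fun z => (Complex.norm_exp_ofReal_mul_I _).le)
    · exact (i2.bdd_mul (c := 1)
        (f := fun v : ℝ => Complex.exp ((-2 * Real.pi * v * ξ : ℝ) * Complex.I))
          (by fun_prop) (ae_of_all _ fun z => (Complex.norm_exp_ofReal_mul_I _).le)).neg
  simp only [e] at h
  rw [h]
  congr 1 with y
  rw [Pi.sub_apply, ← Complex.ofReal_sub, ← ofReal_norm, ← ofReal_norm,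
    Complex.norm_real]

lemma energy_nonneg {t : ℝ} (ht : 0 ≤ t) (ξ : ℝ) : 0 ≤ energy X P' t ξ :=
  intervalIntegral.integral_nonneg ht fun r _ => by positivity

lemma energy_le [IsProbabilityMeasure P'] (hX : IsLevyProcess X P') {t : ℝ} (ht : 0 ≤ t) (ξ : ℝ) :
    energy X P' t ξ ≤ t := by
  have hcont : Continuous fun r => ‖symbol X P' r ξ‖ ^ 2 :=
    (continuous_symbol_time hX ξ).norm.pow 2
  have := intervalIntegral.integral_mono_on (g := fun _ => (1 : ℝ)) ht
    (μ := volume)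
    (hcont.intervalIntegrable 0 t) intervalIntegrable_const
    fun r _ => pow_le_one₀ (norm_nonneg _) (norm_symbol_le_one hX r ξ)
  simpa [energy] using this

lemma lintegral_symbol_sq [IsProbabilityMeasure P'] (hX : IsLevyProcess X P') {t : ℝ}
    (ht : 0 ≤ t) (ξ : ℝ) :
    ∫⁻ s in Set.Icc 0 t, ‖symbol X P' (t - s) ξ‖ₑ ^ 2 = ENNReal.ofReal (energy X P' t ξ) := by
  have hcont : Continuous fun r => ‖symbol X P' (t - r) ξ‖ ^ 2 :=
    (((continuous_symbol_time hX ξ).comp (by fun_prop : Continuous fun r : ℝ => t - r)).norm.pow 2)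
  have e : energy X P' t ξ = ∫ s in Set.Icc 0 t, ‖symbol X P' (t - s) ξ‖ ^ 2 := by
    rw [integral_Icc_eq_integral_Ioc, ← intervalIntegral.integral_of_le ht,
      intervalIntegral.integral_comp_sub_left (fun r => ‖symbol X P' r ξ‖ ^ 2)]
    simp [energy]
  rw [e, ofReal_integral_eq_lintegral_ofReal hcont.continuousOn.integrableOn_Icc
    (ae_of_all _ fun s => by positivity)]
  congr 1 with s
  rw [ENNReal.ofReal_pow (norm_nonneg _), ofReal_norm]

lemma measurable_energy [IsProbabilityMeasure P'] (hX : IsLevyProcess X P') {t : ℝ}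
    (ht : 0 ≤ t) : Measurable (energy X P' t) := by
  have h : Measurable fun ξ => ∫⁻ s in Set.Icc 0 t, ‖symbol X P' (t - s) ξ‖ₑ ^ 2 := by
    refine Measurable.lintegral_prod_right' (f := fun z : ℝ × ℝ => ‖symbol X P' (t - z.2) z.1‖ₑ ^ 2) ?_
    exact (((measurable_symbol hX).comp (by fun_prop :
      Measurable fun z : ℝ × ℝ => (t - z.2, z.1))).enorm).pow_const 2
  convert h.ennreal_toReal using 1
  ext ξ
  rw [lintegral_symbol_sq hX ht, ENNReal.toReal_ofReal (energy_nonneg ht ξ)]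

/-- At a common time `t` the frequency functions factor out of the time integral, and what remains
of it is the energy. -/
lemma eLpNorm_freqKernel_sub [IsProbabilityMeasure P'] (hX : IsLevyProcess X P') {t : ℝ}
    (ht : 0 ≤ t) {g g' : ℝ → ℂ} (hg : Measurable g) (hg' : Measurable g') :
    eLpNorm (fun z => freqKernel X P' t g z - freqKernel X P' t g' z) 2 spaceTimeMeasure
      = eLpNorm (fun ξ => (g ξ - g' ξ) * (√(energy X P' t ξ) : ℂ)) 2 volume := by
  apply eLpNorm_two_eq_of_lintegral_eq
  have m2 : Measurable fun z => ‖freqKernel X P' t g z - freqKernel X P' t g' z‖ₑ ^ 2 :=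
    (((measurable_freqKernel hX t hg).sub (measurable_freqKernel hX t hg')).enorm).pow_const 2
  rw [spaceTimeMeasure_eq_prod, lintegral_prod_symm _ m2.aemeasurable]
  congr 1 with ξ
  have h1 : ∀ s, ‖freqKernel X P' t g (s, ξ) - freqKernel X P' t g' (s, ξ)‖ₑ ^ 2
      = (Set.Iic t).indicator (fun s => ‖g ξ - g' ξ‖ₑ ^ 2 * ‖symbol X P' (t - s) ξ‖ₑ ^ 2) s := by
    intro s
    by_cases h : s ≤ t
    · simp only [freqKernel, h, if_true, Set.indicator, Set.mem_Iic, ← sub_mul, enorm_mul, mul_pow]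
    · simp [freqKernel, h]
  have m3 : Measurable fun s => ‖symbol X P' (t - s) ξ‖ₑ ^ 2 :=
    (((measurable_symbol hX).comp (by fun_prop :
      Measurable fun s : ℝ => (t - s, ξ))).enorm).pow_const 2
  simp only [h1]
  rw [lintegral_indicator measurableSet_Iic, Measure.restrict_restrict measurableSet_Iic,
    Set.inter_comm, Set.Ici_inter_Iic, lintegral_const_mul _ m3, lintegral_symbol_sq hX ht,
    enorm_mul, mul_pow]
  congr 1
  rw [← ofReal_norm, Complex.norm_real, Real.norm_of_nonneg (Real.sqrt_nonneg _),
    ← ENNReal.ofReal_pow (Real.sqrt_nonneg _), Real.sq_sqrt (energy_nonneg ht ξ)]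

lemma memLp_mul_sqrt_energy [IsProbabilityMeasure P'] (hX : IsLevyProcess X P') {t : ℝ}
    (ht : 0 ≤ t) (φ : 𝓢(ℝ, ℂ)) :
    MemLp (fun ξ => φ ξ * (√(energy X P' t ξ) : ℂ)) 2 volume := by
  refine ((φ.memLp 2 volume).norm.const_mul (√t)).mono
    ((φ.continuous.measurable.mul
      (measurable_energy hX ht).sqrt.complex_ofReal).aestronglyMeasurable)
    (ae_of_all _ fun ξ => ?_)
  rw [norm_mul, Complex.norm_real, norm_mul, norm_norm, Real.norm_of_nonneg (Real.sqrt_nonneg _),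
    Real.norm_of_nonneg (Real.sqrt_nonneg _), mul_comm]
  gcongr
  exact energy_le hX ht ξ

lemma memLp_weakKernel [IsProbabilityMeasure P'] (hX : IsLevyProcess X P') {t : ℝ}
    (ht : 0 ≤ t) (φ : 𝓢(ℝ, ℝ)) : MemLp (weakKernel X P' t φ) 2 spaceTimeMeasure := by
  refine ⟨(measurable_weakKernel hX t φ).aestronglyMeasurable, ?_⟩
  have h0 : ∀ z, weakKernel X P' t 0 z = 0 := fun z => by simp [weakKernel, dualSemigroup]
  -- The norm is read off the formula for differences, by subtracting the zero kernel.
  have h := eLpNorm_weakKernel_sub hX t t φ 0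
  rw [eLpNorm_freqKernel_sub hX ht (testFourier φ).continuous.measurable
    (testFourier 0).continuous.measurable] at h
  have h2 : (fun z => weakKernel X P' t φ z - weakKernel X P' t 0 z) = weakKernel X P' t φ := by
    ext z; rw [h0, sub_zero]
  rw [h2] at h
  rw [h]
  exact (memLp_mul_sqrt_energy hX ht (testFourier φ - testFourier 0)).2

/-- If the Fourier transforms of `φₙ → δₓ` are Cauchy in the energy space at time `t > 0`, then
they converge there to the Fourier transform of `δₓ`. -/
lemma TendstoDirac.tendsto_energy [IsProbabilityMeasure P'] (hX : IsLevyProcess X P') {t : ℝ}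
    (ht : 0 < t) {φ : ℕ → 𝓢(ℝ, ℝ)} {x : ℝ} (hφ : TendstoDirac φ x)
    (hc : CauchySeq fun n => (memLp_mul_sqrt_energy hX ht.le (testFourier (φ n))).toLp _) :
    MemLp (fun ξ => diracFourier x ξ * (√(energy X P' t ξ) : ℂ)) 2 volume ∧
    Tendsto (fun n => eLpNorm (fun ξ => (testFourier (φ n) ξ - diracFourier x ξ) *
      (√(energy X P' t ξ) : ℂ)) 2 volume) atTop (𝓝 0) := by
  obtain ⟨G, hG⟩ := cauchySeq_tendsto_of_complete hc
  obtain ⟨c, hc0, hcle⟩ := exists_le_energy hX ht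
  set κ := energy X P' t with hκ
  have hκpos : ∀ ξ, 0 < κ ξ := fun ξ => lt_of_lt_of_le (by positivity) (hcle ξ)
  have hκm : Measurable κ := measurable_energy hX ht.le
  -- Multiplication by `β` replaces the weight `√κ` by `(1 + 2πiξ)⁻¹`. It is bounded by the lower
  -- bound on the energy, so convergence in energy passes to the Sobolev space where the limit is
  -- identified; dividing by `β` brings the identification back.
  let β : ℝ → ℂ := fun ξ => ((√(κ ξ) : ℂ) * (1 + 2 * Real.pi * ξ * Complex.I))⁻¹
  have hβm : Measurable β := by fun_prop
  have hβ : ∀ ξ, ‖β ξ‖ ≤ √(c⁻¹) := by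
    intro ξ
    have h1 : ‖β ξ‖ ^ 2 = (κ ξ * (1 + (2 * Real.pi * ξ) ^ 2))⁻¹ := by
      rw [norm_inv, norm_mul, inv_pow, mul_pow, norm_one_add_two_pi_mul, Complex.norm_real,
        Real.norm_of_nonneg (Real.sqrt_nonneg _), Real.sq_sqrt (hκpos ξ).le]
    apply Real.le_sqrt_of_sq_le
    rw [h1]
    apply inv_anti₀ hc0
    have h2 := hcle ξ
    rw [div_le_iff₀ (by positivity)] at h2
    refine h2.trans ?_
    have h3 : 1 ≤ (2 * Real.pi) ^ 2 := by nlinarith [Real.pi_gt_three]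
    have := hκpos ξ
    refine mul_le_mul_of_nonneg_left ?_ this.le
    rw [mul_pow]
    nlinarith [sq_nonneg ξ]
  have hmul : ∀ F : ℝ → ℂ, MemLp F 2 volume → MemLp (fun ξ => β ξ * F ξ) 2 volume := fun F hF =>
    hF.of_le_mul (c := √(c⁻¹)) (hβm.aestronglyMeasurable.mul hF.1)
      (ae_of_all _ fun ξ => by rw [norm_mul]; gcongr; exact hβ ξ)
  have hg := fun n => memLp_mul_sqrt_energy hX ht.le (testFourier (φ n))
  have hGeq : G =ᵐ[volume] fun ξ => diracFourier x ξ * (√(κ ξ) : ℂ) := by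
    have := hφ.ae_eq_of_tendsto (V := fun n => (hmul _ (hg n)).toLp _)
      (V₀ := (hmul _ (Lp.memLp G)).toLp _) (fun n => ?_) ?_
    · filter_upwards [this, (hmul _ (Lp.memLp G)).coeFn_toLp] with ξ h1 h2
      rw [h2] at h1
      have h3 : (√(κ ξ) : ℂ) ≠ 0 := by
        exact_mod_cast (Real.sqrt_pos.2 (hκpos ξ)).ne'
      have h4 := one_add_two_pi_mul_ne_zero ξ
      simp only [β] at h1
      field_simp at h1
      rw [h1, mul_comm]
    · filter_upwards [(hmul _ (hg n)).coeFn_toLp] with ξ h1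
      rw [h1]
      have h3 : (√(κ ξ) : ℂ) ≠ 0 := by
        exact_mod_cast (Real.sqrt_pos.2 (hκpos ξ)).ne'
      have h4 := one_add_two_pi_mul_ne_zero ξ
      simp only [β]
      field_simp
      ring
    · rw [tendsto_iff_norm_sub_tendsto_zero] at hG ⊢
      refine squeeze_zero (fun _ => norm_nonneg _) (fun n => ?_)
        (by simpa only [mul_zero] using hG.const_mul (√(c⁻¹)))
      refine Lp.norm_le_mul_norm_of_ae_le_mul ?_
      filter_upwards [(hmul _ (hg n)).coeFn_toLp, (hmul _ (Lp.memLp G)).coeFn_toLp,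
        (hg n).coeFn_toLp, Lp.coeFn_sub ((hmul _ (hg n)).toLp _) ((hmul _ (Lp.memLp G)).toLp _),
        Lp.coeFn_sub ((hg n).toLp _) G] with ξ h1 h2 h3 h4 h5
      rw [h4, h5, Pi.sub_apply, Pi.sub_apply, h1, h2, h3, ← mul_sub, norm_mul]
      exact mul_le_mul_of_nonneg_right (hβ ξ) (norm_nonneg _)
  refine ⟨(memLp_congr_ae hGeq).1 (Lp.memLp G), ?_⟩
  rw [Lp.tendsto_Lp_iff_tendsto_eLpNorm'] at hG
  refine hG.congr fun n => eLpNorm_congr_ae ?_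
  filter_upwards [hGeq, (hg n).coeFn_toLp] with ξ h1 h2
  rw [Pi.sub_apply, h1, h2]
  ring

end Kernels

/-! ### Continuity of translations. -/

section Translation

/-- Continuity of translations (composed with a reflection) in `L^p(ℝ²)`. -/
lemma tendsto_eLpNorm_comp_sub_left {E : Type*} [NormedAddCommGroup E] {p : ℝ≥0∞} [Fact (1 ≤ p)]
    (hp : p ≠ ∞) {q : ℝ × ℝ → E} (hq : MemLp q p volume) (a₀ : ℝ × ℝ) :
    Tendsto (fun a : ℝ × ℝ => eLpNorm (fun ζ => q (a - ζ) - q (a₀ - ζ)) p volume) (𝓝 a₀) (𝓝 0) := by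
  let g : C(ℝ × ℝ, C(ℝ × ℝ, ℝ × ℝ)) :=
    (ContinuousMap.mk (fun z : (ℝ × ℝ) × (ℝ × ℝ) => z.1 - z.2) (by fun_prop)).curry
  have hgm : ∀ a, MeasurePreserving (g a) volume volume := fun a =>
    Measure.measurePreserving_sub_left volume a
  have h := (Continuous.compMeasurePreservingLp (f := fun _ => hq.toLp q) continuous_const
    g.continuous hgm hp).tendsto a₀
  rw [Lp.tendsto_Lp_iff_tendsto_eLpNorm'] at h
  refine h.congr fun a => eLpNorm_congr_ae ?_
  have e : ∀ a, Lp.compMeasurePreserving (g a) (hgm a) (hq.toLp q) =ᵐ[volume]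
      fun ζ => q (a - ζ) := fun a =>
    (Lp.coeFn_compMeasurePreserving _ (hgm a)).trans
      ((hgm a).quasiMeasurePreserving.ae_eq_comp hq.coeFn_toLp)
  filter_upwards [e a, e a₀] with ζ h1 h2
  rw [Pi.sub_apply, h1, h2]

end Translation

/-! ### Continuity in space and time of the kernel of a point mass. -/

section FrequencyContinuity

variable {Ω' : Type*} [MeasurableSpace Ω'] {X : ℝ≥0 → Ω' → ℝ} {P' : Measure Ω'}

lemma measurable_diracFourier (x : ℝ) : Measurable (diracFourier x) :=
  (continuous_diracFourier.comp (by fun_prop : Continuous fun ξ : ℝ => (x, ξ))).measurable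

/-- Dominated convergence: the squared integrand is at most four times the energy, as characters
have modulus one. -/
lemma tendsto_freqKernel_space [IsProbabilityMeasure P'] (hX : IsLevyProcess X P') {t : ℝ}
    (ht : 0 ≤ t) (hm : MemLp (fun ξ => (√(energy X P' t ξ) : ℂ)) 2 volume) (x₀ : ℝ) :
    Tendsto (fun x => eLpNorm (fun z => freqKernel X P' t (diracFourier x) z
      - freqKernel X P' t (diracFourier x₀) z) 2 spaceTimeMeasure) (𝓝 x₀) (𝓝 0) := by
  simp only [eLpNorm_freqKernel_sub hX ht (measurable_diracFourier _) (measurable_diracFourier _)]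
  have hlim : Tendsto (fun x => ∫⁻ ξ, ‖(diracFourier x ξ - diracFourier x₀ ξ) *
      (√(energy X P' t ξ) : ℂ)‖ₑ ^ 2) (𝓝 x₀) (𝓝 (∫⁻ _ : ℝ, 0)) := by
    have hfin : ∫⁻ ξ, 4 * ‖(√(energy X P' t ξ) : ℂ)‖ₑ ^ 2 ≠ ∞ := by
      rw [lintegral_const_mul' _ _ (by norm_num), ← eLpNorm_two_sq]
      exact ENNReal.mul_ne_top (by norm_num) (ENNReal.pow_ne_top hm.2.ne)
    refine tendsto_lintegral_filter_of_dominated_convergence _ (Eventually.of_forall fun x => ?_)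
      (Eventually.of_forall fun x => ae_of_all _ fun ξ => ?_) hfin (ae_of_all _ fun ξ => ?_)
    · exact ((((measurable_diracFourier x).sub (measurable_diracFourier x₀)).mul
        (measurable_energy hX ht).sqrt.complex_ofReal).enorm).pow_const 2
    · rw [enorm_mul, mul_pow]
      gcongr
      have : ‖diracFourier x ξ - diracFourier x₀ ξ‖ₑ ≤ 2 := by
        refine (enorm_sub_le).trans ?_
        rw [← ofReal_norm, ← ofReal_norm, norm_diracFourier, norm_diracFourier]
        norm_num
      calc _ ≤ (2 : ℝ≥0∞) ^ 2 := by gcongr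
        _ = 4 := by norm_num
    · have h1 : Continuous fun x => ‖(diracFourier x ξ - diracFourier x₀ ξ) *
          (√(energy X P' t ξ) : ℂ)‖ₑ ^ 2 := by
        have := continuous_diracFourier.comp (by fun_prop : Continuous fun x : ℝ => (x, ξ))
        simp only [Function.comp_def] at this
        have h2 : Continuous fun x => (diracFourier x ξ - diracFourier x₀ ξ) *
          (√(energy X P' t ξ) : ℂ) := (this.sub continuous_const).mul continuous_const
        exact (ENNReal.continuous_pow 2).comp h2.enorm
      simpa using h1.tendsto x₀
  simp only [lintegral_zero, ← eLpNorm_two_sq] at hlim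
  have := (ENNReal.continuous_rpow_const (y := 1 / 2)).tendsto 0 |>.comp hlim
  simp only [Function.comp_def, ← ENNReal.rpow_natCast, ← ENNReal.rpow_mul] at this
  simpa using this

lemma freqKernel_diracFourier (t x : ℝ) (z : ℝ × ℝ) :
    freqKernel X P' t (diracFourier x) z
      = diracFourier x z.2 * freqKernel X P' t (diracFourier 0) z := by
  unfold freqKernel
  split_ifs
  · simp [diracFourier]
  · simp

lemma memLp_freqKernel [IsProbabilityMeasure P'] (hX : IsLevyProcess X P') {t : ℝ} (ht : 0 ≤ t)
    (hm : MemLp (fun ξ => (√(energy X P' t ξ) : ℂ)) 2 volume) (x : ℝ) :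
    MemLp (freqKernel X P' t (diracFourier x)) 2 spaceTimeMeasure := by
  refine ⟨(measurable_freqKernel hX t (measurable_diracFourier x)).aestronglyMeasurable, ?_⟩
  have h := eLpNorm_freqKernel_sub hX ht (measurable_diracFourier x) (g' := 0) measurable_zero
  have e : (fun z => freqKernel X P' t (diracFourier x) z - freqKernel X P' t 0 z)
      = freqKernel X P' t (diracFourier x) := by
    ext z
    simp [freqKernel]
  rw [e] at h
  rw [h]
  refine lt_of_le_of_lt (eLpNorm_mono fun ξ => ?_) hm.2
  simp [norm_diracFourier]

/-- The kernel at time `t` depends on its time variable `s` only through `t - s`. Kernels for nearby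
`t` are thus translates of one square-integrable function, and translations are continuous in `L²`.
-/
lemma tendsto_freqKernel_time
    (hm : ∀ t, 0 ≤ t → MemLp (freqKernel X P' t (diracFourier 0)) 2 spaceTimeMeasure)
    {t₀ : ℝ} (ht₀ : 0 ≤ t₀) :
    Tendsto (fun t => eLpNorm (fun z => freqKernel X P' t (diracFourier 0) z
      - freqKernel X P' t₀ (diracFourier 0) z) 2 spaceTimeMeasure) (𝓝[Set.Ici 0] t₀) (𝓝 0) := by
  set T := t₀ + 1 with hT
  have hS : MeasurableSet spaceTime := measurableSet_Ici.prod MeasurableSet.univ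
  -- A later time `T` is used so that the shifted time `T - t + s` is nonnegative for all `t ≤ T`
  -- and `s ≥ 0`; no mass of the kernel at `t` is then lost to the indicator.
  set F := spaceTime.indicator (freqKernel X P' T (diracFourier 0)) with hF
  have hF2 : MemLp F 2 volume := (memLp_indicator_iff_restrict hS).2 (hm T (by positivity))
  have hq : MemLp (fun ζ : ℝ × ℝ => F ((T, 0) - ζ)) 2 volume :=
    hF2.comp_measurePreserving (Measure.measurePreserving_sub_left volume ((T, 0) : ℝ × ℝ))
  have h := tendsto_eLpNorm_comp_sub_left (by norm_num) hq (t₀, 0)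
  have h2 : Tendsto (fun t : ℝ => (t, (0 : ℝ))) (𝓝[Set.Ici 0] t₀) (𝓝 (t₀, 0)) :=
    ((by fun_prop : Continuous fun t : ℝ => (t, (0 : ℝ))).tendsto t₀).mono_left nhdsWithin_le_nhds
  refine tendsto_of_tendsto_of_tendsto_of_le_of_le' tendsto_const_nhds (h.comp h2)
    (Eventually.of_forall fun _ => zero_le) ?_
  have key : ∀ t, 0 ≤ t → t ≤ T → ∀ z ∈ spaceTime, F ((T, 0) - ((t, 0) - z))
      = freqKernel X P' t (diracFourier 0) z := by
    intro t ht htT z hz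
    have hz1 : 0 ≤ z.1 := hz.1
    have hmem : (T, (0 : ℝ)) - ((t, 0) - z) ∈ spaceTime := by
      refine ⟨?_, trivial⟩
      change 0 ≤ T - (t - z.1)
      linarith
    rw [hF, Set.indicator_of_mem hmem]
    simp only [freqKernel, Prod.fst_sub, Prod.snd_sub, zero_sub, sub_neg_eq_add]
    by_cases h : z.1 ≤ t
    · rw [if_pos h, if_pos (by linarith)]
      congr 2 <;> ring
    · rw [if_neg h, if_neg (by linarith)]
  filter_upwards [self_mem_nhdsWithin, mem_nhdsWithin_of_mem_nhds (Iic_mem_nhds (by linarith :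
    t₀ < T))] with t ht htT
  calc _ = eLpNorm (fun z => F ((T, 0) - ((t, 0) - z)) - F ((T, 0) - ((t₀, 0) - z))) 2
        spaceTimeMeasure := by
        refine eLpNorm_congr_ae ?_
        filter_upwards [ae_restrict_mem hS] with z hz
        rw [key t ht htT z hz, key t₀ ht₀ (by linarith) z hz]
    _ ≤ _ := eLpNorm_mono_measure _ Measure.restrict_le_self

/-- The frequency kernel of the point mass depends continuously on its space-time point. -/
lemma tendsto_freqKernel [IsProbabilityMeasure P'] (hX : IsLevyProcess X P')
    (hm : ∀ t, 0 ≤ t → MemLp (fun ξ => (√(energy X P' t ξ) : ℂ)) 2 volume)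
    {a₀ : ℝ × ℝ} (ha₀ : 0 ≤ a₀.1) :
    Tendsto (fun a : ℝ × ℝ => eLpNorm (fun z => freqKernel X P' a.1 (diracFourier a.2) z
      - freqKernel X P' a₀.1 (diracFourier a₀.2) z) 2 spaceTimeMeasure) (𝓝[spaceTime] a₀)
      (𝓝 0) := by
  have h1 : Tendsto (fun a : ℝ × ℝ => eLpNorm (fun z => freqKernel X P' a.1 (diracFourier 0) z
      - freqKernel X P' a₀.1 (diracFourier 0) z) 2 spaceTimeMeasure) (𝓝[spaceTime] a₀) (𝓝 0) :=
    (tendsto_freqKernel_time (fun t ht => memLp_freqKernel hX ht (hm t ht) 0) ha₀).comp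
      (tendsto_nhdsWithin_iff.2 ⟨(continuous_fst.tendsto a₀).mono_left nhdsWithin_le_nhds,
        by filter_upwards [self_mem_nhdsWithin] with a ha using ha.1⟩)
  have h2 : Tendsto (fun a : ℝ × ℝ => eLpNorm (fun z => freqKernel X P' a₀.1 (diracFourier a.2) z
      - freqKernel X P' a₀.1 (diracFourier a₀.2) z) 2 spaceTimeMeasure) (𝓝[spaceTime] a₀) (𝓝 0) :=
    (tendsto_freqKernel_space hX ha₀ (hm _ ha₀) a₀.2).comp
      ((continuous_snd.tendsto a₀).mono_left nhdsWithin_le_nhds)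
  have h3 := h1.add h2
  rw [add_zero] at h3
  refine tendsto_of_tendsto_of_tendsto_of_le_of_le' tendsto_const_nhds h3
    (Eventually.of_forall fun _ => zero_le) ?_
  filter_upwards [self_mem_nhdsWithin] with a ha
  have m := fun t x => (measurable_freqKernel (P' := P') hX t
    (measurable_diracFourier x)).aestronglyMeasurable (μ := spaceTimeMeasure)
  -- The increment splits into a time increment, multiplied by a character of modulus one, and a
  -- space increment at the fixed time `a₀.1`.
  have e : (fun z => freqKernel X P' a.1 (diracFourier a.2) z
      - freqKernel X P' a₀.1 (diracFourier a₀.2) z)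
      = (fun z => diracFourier a.2 z.2 * (freqKernel X P' a.1 (diracFourier 0) z
        - freqKernel X P' a₀.1 (diracFourier 0) z))
      + fun z => freqKernel X P' a₀.1 (diracFourier a.2) z
        - freqKernel X P' a₀.1 (diracFourier a₀.2) z := by
    ext z
    rw [Pi.add_apply, mul_sub, ← freqKernel_diracFourier, ← freqKernel_diracFourier]
    ring
  rw [e]
  refine (eLpNorm_add_le (((measurable_diracFourier a.2).comp
    measurable_snd).aestronglyMeasurable.mul ((m _ _).sub (m _ _))) ((m _ _).sub (m _ _))
    (by norm_num)).trans ?_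
  gcongr ?_ + _
  refine (eLpNorm_mono fun z => ?_)
  change ‖diracFourier a.2 z.2 * (freqKernel X P' a.1 (diracFourier 0) z
    - freqKernel X P' a₀.1 (diracFourier 0) z)‖ ≤ _
  rw [norm_mul, norm_diracFourier, one_mul]

end FrequencyContinuity

lemma weakSolution_eq {Ω Ω' : Type*} [MeasurableSpace Ω'] {X : ℝ≥0 → Ω' → ℝ} {P' : Measure Ω'}
    [IsProbabilityMeasure P'] (w : Lp ℝ 2 spaceTimeMeasure → Ω → ℝ) (hX : IsLevyProcess X P')
    {t : ℝ} (ht : 0 ≤ t) (φ : 𝓢(ℝ, ℝ)) :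
    weakSolution w X P' t φ = w ((memLp_weakKernel hX ht φ).toLp _) :=
  dif_pos (memLp_weakKernel hX ht φ)

/-! ### From a random-field solution to a continuous map into `L²`. -/

section WhiteNoise

variable {Ω : Type*} [MeasurableSpace Ω] {P : Measure Ω} {w : Lp ℝ 2 spaceTimeMeasure → Ω → ℝ}

lemma IsWhiteNoise.memLp_two (hw : IsWhiteNoise w P) (f : Lp ℝ 2 spaceTimeMeasure) :
    MemLp (w f) 2 P :=
  (hw.gaussian.hasGaussianLaw_eval f).memLp_two

/-- Expanding the square with the covariance formula gives the isometry directly, without linearity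
of `w`, which is not part of the definition. -/
lemma IsWhiteNoise.eLpNorm_sub (hw : IsWhiteNoise w P) (f g : Lp ℝ 2 spaceTimeMeasure) :
    eLpNorm (fun ω => w f ω - w g ω) 2 P = ‖f - g‖ₑ := by
  have hm := (hw.memLp_two f).sub (hw.memLp_two g)
  have hint : ∀ f g, Integrable (fun ω => w f ω * w g ω) P := fun f g =>
    (hw.memLp_two f).integrable_mul (hw.memLp_two g)
  have h1 : ∫ ω, (w f ω - w g ω) ^ 2 ∂P = ‖f - g‖ ^ 2 := by
    have e : ∀ ω, (w f ω - w g ω) ^ 2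
        = w f ω * w f ω - 2 * (w f ω * w g ω) + w g ω * w g ω := fun ω => by ring
    have i1 : Integrable (fun ω => w f ω * w f ω - 2 * (w f ω * w g ω)) P :=
      (hint f f).sub ((hint f g).const_mul 2)
    simp only [e]
    rw [integral_add i1 (hint g g), integral_sub (hint f f) ((hint f g).const_mul 2), integral_const_mul, hw.cov, hw.cov, hw.cov,
      norm_sub_sq_real, real_inner_self_eq_norm_sq, real_inner_self_eq_norm_sq]
  have h2 : eLpNorm (fun ω => w f ω - w g ω) 2 P ^ 2 = ‖f - g‖ₑ ^ 2 := by
    rw [eLpNorm_two_sq, ← ofReal_norm, ← ENNReal.ofReal_pow (norm_nonneg _), ← h1,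
      ofReal_integral_eq_lintegral_ofReal (f := fun ω => (w f ω - w g ω) ^ 2) hm.integrable_sq
        (ae_of_all _ fun ω => sq_nonneg _)]
    congr 1 with ω
    rw [← ofReal_norm, ← ENNReal.ofReal_pow (norm_nonneg _), Real.norm_eq_abs, sq_abs]
  exact (ENNReal.pow_right_strictMono two_ne_zero).injective h2

lemma IsWhiteNoise.map_eq (hw : IsWhiteNoise w P) (f : Lp ℝ 2 spaceTimeMeasure) :
    P.map (w f) = (gaussianReal 0 1).map (fun x => ‖f‖ * x) := by
  have := hw.gaussian.isProbabilityMeasure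
  have hvar : Var[w f; P] = ‖f‖ ^ 2 := by
    rw [variance_of_integral_eq_zero (hw.memLp_two f).aemeasurable (hw.mean f),
      ← real_inner_self_eq_norm_sq, ← hw.cov]
    simp only [sq]
  rw [(hw.gaussian.hasGaussianLaw_eval f).map_eq_gaussianReal, hw.mean, hvar,
    gaussianReal_map_const_mul]
  congr 1
  · simp
  · ext
    simp

lemma IsWhiteNoise.lintegral_pow (hw : IsWhiteNoise w P) (f : Lp ℝ 2 spaceTimeMeasure) (n : ℕ) :
    ∫⁻ ω, ‖w f ω‖ₑ ^ n ∂P = ‖f‖ₑ ^ n * ∫⁻ x, ‖x‖ₑ ^ n ∂(gaussianReal 0 1) := by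
  rw [← lintegral_map' (f := fun x : ℝ => ‖x‖ₑ ^ n) (by fun_prop)
    (hw.memLp_two f).aemeasurable, hw.map_eq, lintegral_map (by fun_prop) (by fun_prop),
    ← lintegral_const_mul _ (by fun_prop)]
  simp only [enorm_mul, mul_pow, enorm_norm]

lemma lintegral_enorm_pow_gaussianReal_ne_top (n : ℕ) :
    ∫⁻ x, ‖x‖ₑ ^ n ∂(gaussianReal 0 1) ≠ ∞ := by
  rcases Nat.eq_zero_or_pos n with rfl | hn
  · simp
  have h := memLp_id_gaussianReal (μ := 0) (v := 1) (n : ℝ≥0)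
  have := eLpNorm_nnreal_pow_eq_lintegral (f := (id : ℝ → ℝ)) (μ := gaussianReal 0 1)
    (p := (n : ℝ≥0)) (by exact_mod_cast hn.ne')
  simp only [NNReal.coe_natCast, ENNReal.rpow_natCast, id] at this
  rw [← this]
  exact ENNReal.pow_ne_top h.2.ne

variable {Ω' : Type*} [MeasurableSpace Ω'] {X : ℝ≥0 → Ω' → ℝ} {P' : Measure Ω'}

/-- A random-field solution is, at each point, the white noise evaluated at the limit of the
kernels of the weak solutions. -/
lemma IsRandomFieldSolution.exists_limit [IsProbabilityMeasure P'] (hX : IsLevyProcess X P')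
    (hw : IsWhiteNoise w P) {H : ℝ → ℝ → Ω → ℝ} (hH : IsRandomFieldSolution w P X P' H)
    {t : ℝ} (ht : 0 ≤ t) (x : ℝ) :
    ∃ (f : Lp ℝ 2 spaceTimeMeasure) (φ : ℕ → 𝓢(ℝ, ℝ)), H t x =ᵐ[P] w f ∧ TendstoDirac φ x ∧
      Tendsto (fun n => (memLp_weakKernel hX ht (φ n)).toLp _) atTop (𝓝 f) := by
  obtain ⟨hmeas, φ, hφ, hlim⟩ := hH t ht x
  set F : ℕ → Lp ℝ 2 spaceTimeMeasure := fun n => (memLp_weakKernel hX ht (φ n)).toLp _ with hF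
  simp only [weakSolution_eq w hX ht] at hlim
  have hm : ∀ f, AEStronglyMeasurable (w f) P := fun f => (hw.memLp_two f).1
  have hmH : AEStronglyMeasurable (H t x) P := hmeas.aestronglyMeasurable
  -- The isometry, read backwards, turns convergence of the random variables into a Cauchy property
  -- of their kernels.
  have htri : ∀ f g, ‖f - g‖ₑ ≤ eLpNorm (fun ω => w f ω - H t x ω) 2 P
      + eLpNorm (fun ω => w g ω - H t x ω) 2 P := by
    intro f g
    rw [← hw.eLpNorm_sub]
    have e : (fun ω => w f ω - w g ω)
        = (fun ω => w f ω - H t x ω) - fun ω => w g ω - H t x ω := by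
      ext ω
      simp
    rw [e]
    exact eLpNorm_sub_le ((hm f).sub hmH) ((hm g).sub hmH) (by norm_num)
  have hcauchy : CauchySeq F := by
    rw [EMetric.cauchySeq_iff]
    intro ε hε
    obtain ⟨N, hN⟩ := eventually_atTop.1 (hlim.eventually (gt_mem_nhds (ENNReal.half_pos hε.ne')))
    refine ⟨N, fun m hm n hn => ?_⟩
    rw [edist_eq_enorm_sub]
    calc _ ≤ _ := htri (F m) (F n)
      _ < ε / 2 + ε / 2 := ENNReal.add_lt_add (hN m hm) (hN n hn)
      _ = ε := ENNReal.add_halves ε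
  obtain ⟨f, hf⟩ := cauchySeq_tendsto_of_complete hcauchy
  refine ⟨f, φ, ?_, hφ, hf⟩
  have hbound : ∀ n, eLpNorm (fun ω => H t x ω - w f ω) 2 P
      ≤ eLpNorm (fun ω => w (F n) ω - H t x ω) 2 P + ‖F n - f‖ₑ := by
    intro n
    rw [← hw.eLpNorm_sub, add_comm]
    have e : (fun ω => H t x ω - w f ω)
        = (fun ω => w (F n) ω - w f ω) - fun ω => w (F n) ω - H t x ω := by
      ext ω
      simp
    rw [e]
    exact eLpNorm_sub_le ((hm _).sub (hm _)) ((hm _).sub hmH) (by norm_num)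
  have hlim2 : Tendsto (fun n => ‖F n - f‖ₑ) atTop (𝓝 0) := by
    have := tendsto_iff_edist_tendsto_0.1 hf
    simpa only [edist_eq_enorm_sub] using this
  have hz : eLpNorm (fun ω => H t x ω - w f ω) 2 P = 0 := by
    have := ge_of_tendsto' (hlim.add hlim2) hbound
    simpa using this
  have hz' := (eLpNorm_eq_zero_iff (hmH.sub (hm f)) (by norm_num)).1 hz
  filter_upwards [hz'] with ω hω
  simpa [sub_eq_zero] using hω

lemma enorm_toLp_weakKernel_sub [IsProbabilityMeasure P'] (hX : IsLevyProcess X P') {t t' : ℝ}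
    (ht : 0 ≤ t) (ht' : 0 ≤ t') (φ φ' : 𝓢(ℝ, ℝ)) :
    ‖(memLp_weakKernel hX ht φ).toLp _ - (memLp_weakKernel hX ht' φ').toLp _‖ₑ
      = eLpNorm (fun z => freqKernel X P' t (testFourier φ) z
        - freqKernel X P' t' (testFourier φ') z) 2 spaceTimeMeasure := by
  rw [← eLpNorm_weakKernel_sub hX, ← MemLp.toLp_sub, Lp.enorm_toLp]
  rfl

/-- The Fourier transform of `δₓ` has modulus one, so finite energy of the limit says precisely that
the energy density is integrable. At `t = 0` the energy vanishes. -/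
lemma TendstoDirac.tendsto_freqKernel [IsProbabilityMeasure P']
    (hX : IsLevyProcess X P') {t : ℝ} (ht : 0 ≤ t) {x : ℝ} {φ : ℕ → 𝓢(ℝ, ℝ)}
    (hφ : TendstoDirac φ x) {f : Lp ℝ 2 spaceTimeMeasure}
    (hf : Tendsto (fun n => (memLp_weakKernel hX ht (φ n)).toLp _) atTop (𝓝 f)) :
    MemLp (fun ξ => (√(energy X P' t ξ) : ℂ)) 2 volume ∧
    Tendsto (fun n => eLpNorm (fun z => freqKernel X P' t (testFourier (φ n)) z
      - freqKernel X P' t (diracFourier x) z) 2 spaceTimeMeasure) atTop (𝓝 0) := by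
  have hmφ : ∀ n, Measurable (testFourier (φ n)) := fun n =>
    (testFourier (φ n)).continuous.measurable
  simp only [eLpNorm_freqKernel_sub hX ht (hmφ _) (measurable_diracFourier _)]
  rcases ht.eq_or_lt with rfl | htpos
  · have : ∀ ξ, energy X P' 0 ξ = 0 := fun ξ => intervalIntegral.integral_same
    simp [this]
  have hc : CauchySeq fun n =>
      (memLp_mul_sqrt_energy hX htpos.le (testFourier (φ n))).toLp _ := by
    have h1 := hf.cauchySeq
    rw [EMetric.cauchySeq_iff] at h1 ⊢
    intro ε hε
    obtain ⟨N, hN⟩ := h1 ε hε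
    refine ⟨N, fun m hm n hn => ?_⟩
    have h2 := hN m hm n hn
    rw [edist_eq_enorm_sub, enorm_toLp_weakKernel_sub hX ht ht,
      eLpNorm_freqKernel_sub hX ht (hmφ _) (hmφ _)] at h2
    rw [edist_eq_enorm_sub, ← MemLp.toLp_sub, Lp.enorm_toLp]
    refine lt_of_eq_of_lt (congrArg (eLpNorm · 2 volume) ?_) h2
    ext ξ
    simp [sub_mul]
  obtain ⟨h1, h2⟩ := hφ.tendsto_energy hX htpos hc
  refine ⟨h1.of_le ?_ (ae_of_all _ fun ξ => ?_), h2⟩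
  · exact (measurable_energy hX ht).sqrt.complex_ofReal.aestronglyMeasurable
  · rw [norm_mul, norm_diracFourier, one_mul]

/-- A random-field solution has finite energy, and is the white noise evaluated along a continuous
curve in `L²`. -/
theorem IsRandomFieldSolution.exists_continuous_kernel [IsProbabilityMeasure P']
    (hX : IsLevyProcess X P') (hw : IsWhiteNoise w P) {H : ℝ → ℝ → Ω → ℝ}
    (hH : IsRandomFieldSolution w P X P' H) :
    (∀ t, 0 ≤ t → MemLp (fun ξ => (√(energy X P' t ξ) : ℂ)) 2 volume) ∧
    ∃ f : ℝ × ℝ → Lp ℝ 2 spaceTimeMeasure, Continuous f ∧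
      ∀ t, 0 ≤ t → ∀ x, H t x =ᵐ[P] w (f (t, x)) := by
  choose f φ hf1 hf2 hf3 using fun (t : ℝ) (ht : 0 ≤ t) (x : ℝ) => hH.exists_limit hX hw ht x
  have hE : ∀ t, 0 ≤ t → MemLp (fun ξ => (√(energy X P' t ξ) : ℂ)) 2 volume := fun t ht =>
    ((hf2 t ht 0).tendsto_freqKernel hX ht (hf3 t ht 0)).1
  -- Negative times are frozen at `0`, which makes the map continuous on the whole plane.
  refine ⟨hE, fun a => f (max a.1 0) (le_max_right _ _) a.2, ?_, fun t ht x => ?_⟩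
  swap
  · have : ∀ s (hs : 0 ≤ s), s = t → H t x =ᵐ[P] w (f s hs x) := by
      rintro s hs rfl
      exact hf1 s hs x
    exact this _ _ (max_eq_left ht)
  have hK := fun (t : ℝ) (ht : 0 ≤ t) (x : ℝ) => memLp_freqKernel hX ht (hE t ht) x
  have hKφ : ∀ (t : ℝ) (ht : 0 ≤ t) (φ : 𝓢(ℝ, ℝ)),
      MemLp (freqKernel X P' t (testFourier φ)) 2 spaceTimeMeasure := by
    intro t ht φ
    refine ⟨(measurable_freqKernel hX t
      (testFourier φ).continuous.measurable).aestronglyMeasurable, ?_⟩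
    have h0 : ∀ z, freqKernel X P' t (testFourier 0) z = 0 := fun z => by
      have : testFourier 0 = 0 := by
        have h : complexify 0 = 0 := by ext; simp
        rw [testFourier, h]
        exact map_zero (FourierTransform.fourierCLM ℂ 𝓢(ℝ, ℂ))
      rw [this]
      simp [freqKernel]
    have h := enorm_toLp_weakKernel_sub hX ht ht φ 0
    simp only [h0, sub_zero] at h
    rw [← h]
    exact enorm_lt_top
  have hlim : ∀ (t : ℝ) (ht : 0 ≤ t) (x : ℝ), Tendsto (fun n => (hKφ t ht (φ t ht x n)).toLp _)
      atTop (𝓝 ((hK t ht x).toLp _)) := by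
    intro t ht x
    rw [Lp.tendsto_Lp_iff_tendsto_eLpNorm'']
    exact ((hf2 t ht x).tendsto_freqKernel hX ht (hf3 t ht x)).2
  -- The limits `f` have no explicit formula in physical space, but their mutual distances are those
  -- of the explicit frequency kernels, since this holds along the approximating sequences.
  have hiso : ∀ (t : ℝ) (ht : 0 ≤ t) (x t' : ℝ) (ht' : 0 ≤ t') (x' : ℝ),
      edist (f t ht x) (f t' ht' x') = eLpNorm (fun z => freqKernel X P' t (diracFourier x) z
        - freqKernel X P' t' (diracFourier x') z) 2 spaceTimeMeasure := by
    intro t ht x t' ht' x'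
    have h1 := (hf3 t ht x).edist (hf3 t' ht' x')
    have h2 := (hlim t ht x).edist (hlim t' ht' x')
    have h3 : ∀ n, edist ((memLp_weakKernel hX ht (φ t ht x n)).toLp _)
        ((memLp_weakKernel hX ht' (φ t' ht' x' n)).toLp _)
        = edist ((hKφ t ht (φ t ht x n)).toLp _) ((hKφ t' ht' (φ t' ht' x' n)).toLp _) := by
      intro n
      rw [edist_eq_enorm_sub, enorm_toLp_weakKernel_sub hX ht ht', Lp.edist_toLp_toLp]
      rfl
    simp only [h3] at h1
    rw [tendsto_nhds_unique h1 h2, Lp.edist_toLp_toLp]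
    rfl
  rw [continuous_iff_continuousAt]
  intro a₀
  rw [ContinuousAt, tendsto_iff_edist_tendsto_0]
  simp only [hiso]
  have h := tendsto_freqKernel hX hE (a₀ := (max a₀.1 0, a₀.2)) (le_max_right _ _)
  refine h.comp (f := fun a : ℝ × ℝ => (max a.1 0, a.2)) (tendsto_nhdsWithin_iff.2 ⟨?_, ?_⟩)
  · exact (by fun_prop : Continuous fun a : ℝ × ℝ => (max a.1 0, a.2)).tendsto a₀
  · exact Eventually.of_forall fun a => ⟨(le_max_right _ _ : (0 : ℝ) ≤ max a.1 0), trivial⟩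

end WhiteNoise

/-! ### A jointly measurable modification and its local integrability. -/

section Modification

variable {Ω : Type*} [MeasurableSpace Ω] {P : Measure Ω} {w : Lp ℝ 2 spaceTimeMeasure → Ω → ℝ}

/-- The expectation of the sum of squared errors is finite, so almost surely this sum converges and
its terms tend to zero. -/
lemma ae_tendsto_of_summable_eLpNorm {Z : ℕ → Ω → ℝ} {Y : Ω → ℝ}
    (hZ : ∀ n, AEStronglyMeasurable (Z n) P) (hY : AEStronglyMeasurable Y P)
    (h : ∑' n, eLpNorm (fun ω => Z n ω - Y ω) 2 P ^ 2 ≠ ∞) :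
    ∀ᵐ ω ∂P, Tendsto (fun n => Z n ω) atTop (𝓝 (Y ω)) := by
  simp only [eLpNorm_two_sq] at h
  have hm : ∀ n, AEMeasurable (fun ω => ‖Z n ω - Y ω‖ₑ ^ 2) P := fun n =>
    (((hZ n).sub hY).enorm).pow_const 2
  rw [← lintegral_tsum hm] at h
  filter_upwards [ae_lt_top' (AEMeasurable.tsum hm) h] with ω hω
  have h1 := ENNReal.tendsto_atTop_zero_of_tsum_ne_top hω.ne
  have h2 := (ENNReal.continuous_rpow_const (y := 1 / 2)).tendsto 0 |>.comp h1
  simp only [Function.comp_def, ← ENNReal.rpow_natCast, ← ENNReal.rpow_mul] at h2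
  rw [tendsto_iff_edist_tendsto_0]
  simpa [edist_eq_enorm_sub] using h2

/-- The lower-left corner of the cell of the grid of mesh `1 / N` which contains `(t, x)`. -/
def gridPoint (N : ℕ) (a : ℝ × ℝ) : ℝ × ℝ := (⌊N * a.1⌋ / N, ⌊N * a.2⌋ / N)

lemma dist_gridPoint_le {N : ℕ} (hN : 0 < N) (a : ℝ × ℝ) : dist (gridPoint N a) a ≤ 1 / N := by
  have hN' : (0 : ℝ) < N := by exact_mod_cast hN
  have key : ∀ x : ℝ, dist ((⌊N * x⌋ : ℝ) / N) x ≤ 1 / N := by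
    intro x
    rw [Real.dist_eq, div_sub' hN'.ne', abs_div, abs_of_pos hN']
    gcongr
    rw [abs_sub_comm, abs_le]
    constructor <;> linarith [Int.floor_le (N * x), Int.lt_floor_add_one (N * x)]
  exact max_le (key _) (key _)

/-- A white noise, evaluated along a continuous curve in `L²`, has a jointly measurable
modification. -/
theorem IsWhiteNoise.exists_measurable_modification (hw : IsWhiteNoise w P)
    {f : ℝ × ℝ → Lp ℝ 2 spaceTimeMeasure} (hf : Continuous f) :
    ∃ H : ℝ → ℝ → Ω → ℝ, Measurable (fun q : ℝ × ℝ × Ω => H q.1 q.2.1 q.2.2) ∧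
      ∀ t x, H t x =ᵐ[P] w (f (t, x)) := by
  -- Uniform continuity on the ball of radius `k + 1`: this contains the grid point as well as `a`,
  -- since the mesh is below `1`.
  have huc : ∀ k : ℕ, ∃ N : ℕ, 0 < N ∧ ∀ a ∈ Metric.closedBall (0 : ℝ × ℝ) k,
      ‖f (gridPoint N a) - f a‖ₑ ≤ 2⁻¹ ^ k := by
    intro k
    have h1 := (isCompact_closedBall (0 : ℝ × ℝ) (k + 1)).uniformContinuousOn_of_continuous
      hf.continuousOn
    rw [Metric.uniformContinuousOn_iff] at h1
    obtain ⟨δ, hδ, h⟩ := h1 (2⁻¹ ^ k) (by positivity)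
    obtain ⟨N, hN⟩ := exists_nat_one_div_lt (lt_min hδ one_pos)
    refine ⟨N + 1, N.succ_pos, fun a ha => ?_⟩
    have hd := dist_gridPoint_le N.succ_pos a
    have hd' : dist (gridPoint (N + 1) a) a < min δ 1 := by
      refine hd.trans_lt ?_
      push_cast
      exact hN
    have ha' : dist a 0 ≤ k := ha
    have h3 := h (gridPoint (N + 1) a) (by
      rw [Metric.mem_closedBall]
      linarith [dist_triangle (gridPoint (N + 1) a) a 0, hd'.trans_le (min_le_right δ 1)]) a
      (Metric.closedBall_subset_closedBall (by linarith) ha) (hd'.trans_le (min_le_left _ _))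
    rw [dist_eq_norm] at h3
    rw [← ofReal_norm]
    calc ENNReal.ofReal ‖f (gridPoint (N + 1) a) - f a‖ ≤ ENNReal.ofReal (2⁻¹ ^ k) :=
          ENNReal.ofReal_le_ofReal h3.le
      _ = 2⁻¹ ^ k := by
          rw [ENNReal.ofReal_pow (by norm_num), ENNReal.ofReal_inv_of_pos two_pos]
          norm_num
  choose N hN0 hN using huc
  -- Each `w g` is replaced by a measurable version. Only countably many are used in each
  -- approximation, as it takes values at grid points, which gives joint measurability.
  have hae : ∀ g, AEMeasurable (w g) P := fun g => (hw.memLp_two g).aemeasurable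
  choose W hWm hW using hae
  let Z : ℕ → ℝ × ℝ × Ω → ℝ := fun k q => W (f (gridPoint (N k) (q.1, q.2.1))) q.2.2
  have hZ : ∀ k, Measurable (Z k) := by
    intro k
    have h1 : Measurable fun q : (ℤ × ℤ) × Ω =>
        W (f ((q.1.1 : ℝ) / N k, (q.1.2 : ℝ) / N k)) q.2 :=
      measurable_from_prod_countable_right fun m => hWm (f ((m.1 : ℝ) / N k, (m.2 : ℝ) / N k))
    exact h1.comp (g := fun q : (ℤ × ℤ) × Ω => W (f ((q.1.1 : ℝ) / N k, (q.1.2 : ℝ) / N k)) q.2)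
      (f := fun q : ℝ × ℝ × Ω => ((⌊N k * q.1⌋, ⌊N k * q.2.1⌋), q.2.2)) (by fun_prop)
  -- The upper limit is measurable at every point and agrees with the limit wherever that exists.
  refine ⟨fun t x ω => limsup (fun k => Z k (t, x, ω)) atTop, Measurable.limsup hZ,
    fun t x => ?_⟩
  have hlim : ∀ᵐ ω ∂P, Tendsto (fun k => Z k (t, x, ω)) atTop (𝓝 (w (f (t, x)) ω)) := by
    obtain ⟨K, hK⟩ := exists_nat_ge ‖(t, x)‖
    have hsum : ∑' n, eLpNorm (fun ω => Z (n + K) (t, x, ω) - w (f (t, x)) ω) 2 P ^ 2 ≠ ∞ := by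
      have hterm : ∀ n, eLpNorm (fun ω => Z (n + K) (t, x, ω) - w (f (t, x)) ω) 2 P ^ 2
          ≤ 2⁻¹ ^ n := by
        intro n
        have e : eLpNorm (fun ω => Z (n + K) (t, x, ω) - w (f (t, x)) ω) 2 P
            = ‖f (gridPoint (N (n + K)) (t, x)) - f (t, x)‖ₑ := by
          rw [← hw.eLpNorm_sub]
          refine eLpNorm_congr_ae ?_
          filter_upwards [hW (f (gridPoint (N (n + K)) (t, x)))] with ω hω
          rw [hω]
        have h1 : (t, x) ∈ Metric.closedBall (0 : ℝ × ℝ) ((n + K : ℕ) : ℝ) := by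
          rw [mem_closedBall_zero_iff]
          refine hK.trans ?_
          exact_mod_cast Nat.le_add_left K n
        have h2 : (2⁻¹ : ℝ≥0∞) ≤ 1 := ENNReal.inv_le_one.2 one_le_two
        rw [e]
        calc _ ≤ ((2⁻¹ : ℝ≥0∞) ^ (n + K)) ^ 2 := by gcongr; exact hN _ _ h1
          _ = 2⁻¹ ^ ((n + K) * 2) := by rw [← pow_mul]
          _ ≤ _ := pow_le_pow_right_of_le_one' h2 (by omega)
      refine ne_top_of_le_ne_top ?_ (ENNReal.tsum_le_tsum hterm)
      rw [ENNReal.tsum_geometric, ENNReal.one_sub_inv_two, inv_inv]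
      norm_num
    have := ae_tendsto_of_summable_eLpNorm (Z := fun n ω => Z (n + K) (t, x, ω))
      (fun k => (hWm (f (gridPoint (N (k + K)) (t, x)))).aestronglyMeasurable) (hw.memLp_two _).1 hsum
    filter_upwards [this] with ω hω
    exact (tendsto_add_atTop_iff_nat K).1 hω
  filter_upwards [hlim] with ω hω using hω.limsup_eq

/-- The modification is almost surely locally in every `L^q`, `q < ∞`. -/
theorem IsWhiteNoise.ae_memLpLoc (hw : IsWhiteNoise w P)
    {f : ℝ × ℝ → Lp ℝ 2 spaceTimeMeasure} (hf : Continuous f) {H : ℝ → ℝ → Ω → ℝ}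
    (hH : Measurable (fun q : ℝ × ℝ × Ω => H q.1 q.2.1 q.2.2))
    (hHf : ∀ t, 0 ≤ t → ∀ x, H t x =ᵐ[P] w (f (t, x))) :
    ∀ᵐ ω ∂P, ∀ q : ℝ≥0∞, q ≠ ∞ → MemLpLoc (fun t x => H t x ω) q := by
  have := hw.gaussian.isProbabilityMeasure
  -- Fubini: the expected local integral is finite because Gaussian moments depend only on the norm
  -- of `f`, which is bounded on compact sets.
  have hmain : ∀ N n : ℕ, ∀ᵐ ω ∂P, ∫⁻ z in Metric.closedBall (0 : ℝ × ℝ) N ∩ spaceTime,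
      ‖H z.1 z.2 ω‖ₑ ^ n < ∞ := by
    intro N n
    have hS : MeasurableSet (Metric.closedBall (0 : ℝ × ℝ) N ∩ spaceTime) :=
      Metric.isClosed_closedBall.measurableSet.inter (measurableSet_Ici.prod MeasurableSet.univ)
    have hm : Measurable fun q : Ω × (ℝ × ℝ) => ‖H q.2.1 q.2.2 q.1‖ₑ ^ n :=
      ((hH.comp (by fun_prop : Measurable fun q : Ω × (ℝ × ℝ) =>
        (q.2.1, q.2.2, q.1))).enorm).pow_const n
    refine ae_lt_top hm.lintegral_prod_right' ?_
    rw [lintegral_lintegral_swap hm.aemeasurable]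
    obtain ⟨C, hC⟩ := (isCompact_closedBall (0 : ℝ × ℝ) N).exists_bound_of_continuousOn
      hf.continuousOn
    set c := ∫⁻ x, ‖x‖ₑ ^ n ∂(gaussianReal 0 1) with hc
    have hle : ∫⁻ z in Metric.closedBall (0 : ℝ × ℝ) N ∩ spaceTime, ∫⁻ ω, ‖H z.1 z.2 ω‖ₑ ^ n ∂P
        ≤ ∫⁻ z in Metric.closedBall (0 : ℝ × ℝ) N ∩ spaceTime, ENNReal.ofReal C ^ n * c := by
      refine setLIntegral_mono measurable_const fun z hz => ?_
      have e : ∫⁻ ω, ‖H z.1 z.2 ω‖ₑ ^ n ∂P = ∫⁻ ω, ‖w (f z) ω‖ₑ ^ n ∂P := by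
        refine lintegral_congr_ae ?_
        filter_upwards [hHf z.1 hz.2.1 z.2] with ω hω
        rw [hω]
      rw [e, hw.lintegral_pow]
      gcongr
      rw [← ofReal_norm]
      exact ENNReal.ofReal_le_ofReal (hC z hz.1)
    refine ne_top_of_le_ne_top ?_ hle
    rw [setLIntegral_const]
    refine ENNReal.mul_ne_top (ENNReal.mul_ne_top (ENNReal.pow_ne_top ENNReal.ofReal_ne_top)
      (lintegral_enorm_pow_gaussianReal_ne_top n)) ?_
    exact ((measure_mono Set.inter_subset_left).trans_lt measure_closedBall_lt_top).ne
  have hall := ae_all_iff.2 fun N => ae_all_iff.2 (hmain N)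
  filter_upwards [hall] with ω hω q hq K hK hKs
  obtain ⟨N, hN⟩ := hK.isBounded.subset_closedBall (0 : ℝ × ℝ) |>.imp fun r hr =>
    hr.trans (Metric.closedBall_subset_closedBall (Nat.le_ceil r))
  obtain ⟨n, hn⟩ : ∃ n : ℕ, q ≤ n := ENNReal.exists_nat_gt hq |>.imp fun n hn => hn.le
  have hmeas : Measurable fun z : ℝ × ℝ => H z.1 z.2 ω :=
    hH.comp (by fun_prop : Measurable fun z : ℝ × ℝ => (z.1, z.2, ω))
  have hfin : IsFiniteMeasure ((volume : Measure (ℝ × ℝ)).restrict K) :=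
    ⟨by rw [Measure.restrict_apply_univ]; exact hK.measure_lt_top⟩
  -- The exponent `n + 1` is nonzero even if `q = 0`; lower exponents follow because `K` has finite
  -- measure.
  have hn' : MemLp (fun z : ℝ × ℝ => H z.1 z.2 ω) ((n + 1 : ℕ) : ℝ≥0)
      (volume.restrict (Metric.closedBall (0 : ℝ × ℝ) ⌈N⌉₊ ∩ spaceTime)) := by
    refine ⟨hmeas.aestronglyMeasurable, ?_⟩
    have h1 := eLpNorm_nnreal_pow_eq_lintegral (f := fun z : ℝ × ℝ => H z.1 z.2 ω)
      (μ := volume.restrict (Metric.closedBall (0 : ℝ × ℝ) ⌈N⌉₊ ∩ spaceTime))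
      (p := ((n + 1 : ℕ) : ℝ≥0)) (by positivity)
    simp only [NNReal.coe_natCast, ENNReal.rpow_natCast] at h1
    refine lt_top_iff_ne_top.2 fun htop => ?_
    rw [htop, ENNReal.top_pow n.succ_ne_zero] at h1
    exact (hω ⌈N⌉₊ (n + 1)).ne h1.symm
  refine (hn'.mono_measure (Measure.restrict_mono (Set.subset_inter hN hKs) le_rfl)).mono_exponent
    (hn.trans ?_)
  push_cast
  exact le_self_add

end Modification

/-! ### Densities by Fourier inversion. -/

section Density

/-- A probability measure with integrable characteristic function has the density given by the
Fourier inversion formula. -/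
theorem eq_withDensity_of_integrable_charFun {μ : Measure ℝ} [IsProbabilityMeasure μ]
    (h : Integrable fun ξ : ℝ => charFun μ (2 * Real.pi * ξ)) :
    μ = volume.withDensity
      fun x => ENNReal.ofReal (𝓕 (fun ξ : ℝ => charFun μ (2 * Real.pi * ξ)) x).re := by
  set g : ℝ → ℂ := fun ξ => charFun μ (2 * Real.pi * ξ) with hg
  set q : ℝ → ℝ := fun x => (𝓕 g x).re with hq
  have hgc : Continuous (𝓕 g) := VectorFourier.fourierIntegral_continuous
    Real.continuous_fourierChar (L := innerₗ ℝ) continuous_inner h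
  have hqc : Continuous q := Complex.continuous_re.comp hgc
  -- Parseval's identity for `μ`: Fourier inversion of `ψ` and Fubini.
  have htestc : ∀ ψ : 𝓢(ℝ, ℂ), ∫ x, ψ x ∂μ = ∫ x, ψ x * 𝓕 g x := by
    intro ψ
    have h1 : ∫ x, ψ x * 𝓕 g x = ∫ ξ, 𝓕 ψ ξ * g ξ := by
      simpa using! (VectorFourier.integral_fourierIntegral_smul_eq_flip (L := innerₗ ℝ)
          Real.continuous_fourierChar continuous_inner ψ.integrable h).symm
    have h2 : ∀ x, ψ x = ∫ ξ, Complex.exp ((2 * Real.pi * ξ * x : ℝ) * Complex.I) * 𝓕 ψ ξ := by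
      intro x
      have : ψ x = 𝓕⁻ (𝓕 ψ) x := by rw [FourierTransform.fourierInv_fourier_eq]
      rw [this, SchwartzMap.fourierInv_coe, Real.fourierInv_eq']
      simp only [smul_eq_mul]
      congr 1 with ξ
      congr 2
      simp [mul_comm]
      ring
    have hint : Integrable (fun z : ℝ × ℝ =>
        Complex.exp ((2 * Real.pi * z.2 * z.1 : ℝ) * Complex.I) * 𝓕 ψ z.2) (μ.prod volume) := by
      refine Integrable.bdd_mul (c := 1) ((𝓕 ψ).integrable.comp_snd μ) (by fun_prop)
        (ae_of_all _ fun z => (Complex.norm_exp_ofReal_mul_I _).le)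
    rw [h1, integral_congr_ae (ae_of_all _ h2), integral_integral_swap hint]
    congr 1 with ξ
    rw [integral_mul_const, mul_comm]
    simp only [hg, charFun_apply_real]
    congr 3 with x
    push_cast
    rfl
  have htest : ∀ ψ : ℝ → ℝ, ContDiff ℝ (⊤ : ℕ∞) ψ → HasCompactSupport ψ →
      ∫ x, ψ x ∂μ = ∫ x, ψ x * q x := by
    intro ψ hψ hψc
    have hgc' : HasCompactSupport (Complex.ofRealCLM ∘ ψ) := hψc.comp_left rfl
    have hg' : ContDiff ℝ (⊤ : ℕ∞) (Complex.ofRealCLM ∘ ψ) := Complex.ofRealCLM.contDiff.comp hψ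
    have h1 := congrArg Complex.re (htestc (hgc'.toSchwartzMap hg'))
    have hint : Integrable fun x => hgc'.toSchwartzMap hg' x * 𝓕 g x :=
      ((hgc'.toSchwartzMap hg').continuous.mul hgc).integrable_of_hasCompactSupport hgc'.mul_right
    have hint2 : Integrable (hgc'.toSchwartzMap hg') μ :=
      (hgc'.toSchwartzMap hg').continuous.integrable_of_hasCompactSupport hgc'
    rw [← RCLike.re_eq_complex_re, ← integral_re hint, ← integral_re hint2] at h1
    simpa using h1
  -- Absolute continuity of `μ` is not yet known, so `μ` and Lebesgue measure are compared through
  -- their densities with respect to `ρ`. Nonnegativity of `q` need not be shown separately: the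
  -- real identity between densities is pushed through `ENNReal.ofReal`.
  set ρ : Measure ℝ := μ + volume with hρ
  have hμρ : μ ≪ ρ := Measure.absolutelyContinuous_of_le (Measure.le_add_right le_rfl)
  have hvρ : (volume : Measure ℝ) ≪ ρ :=
    Measure.absolutelyContinuous_of_le (Measure.le_add_left le_rfl)
  have hae : ∀ᵐ x ∂ρ, (μ.rnDeriv ρ x).toReal
      = ((volume : Measure ℝ).rnDeriv ρ x).toReal * q x := by
    refine ae_eq_of_integral_contDiff_smul_eq Measure.integrable_toReal_rnDeriv.locallyIntegrable
      ?_ fun ψ hψ hψc => ?_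
    · rw [locallyIntegrable_iff]
      intro K hK
      rw [← integrable_indicator_iff hK.measurableSet]
      have h1 : Integrable (K.indicator q) volume :=
        (integrable_indicator_iff hK.measurableSet).2 (hqc.continuousOn.integrableOn_compact hK)
      have h2 := (integrable_rnDeriv_smul_iff hvρ).2 h1
      refine h2.congr (ae_of_all _ fun x => ?_)
      by_cases hx : x ∈ K <;> simp [hx]
    · have h1 := integral_rnDeriv_smul hμρ (f := ψ)
      have h2 := integral_rnDeriv_smul hvρ (f := fun x => ψ x * q x)
      calc ∫ x, ψ x • (μ.rnDeriv ρ x).toReal ∂ρ = ∫ x, (μ.rnDeriv ρ x).toReal • ψ x ∂ρ := by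
            simp only [smul_eq_mul, mul_comm]
        _ = ∫ x, ((volume : Measure ℝ).rnDeriv ρ x).toReal • (ψ x * q x) ∂ρ := by
            rw [h1, htest ψ hψ hψc, h2]
        _ = _ := by
            congr 1 with x
            simp only [smul_eq_mul]
            ring
  have hfin : ∀ ν : Measure ℝ, SigmaFinite ν → ∀ᵐ x ∂ρ, ν.rnDeriv ρ x ≠ ∞ := fun ν _ => by
    filter_upwards [Measure.rnDeriv_lt_top ν ρ] with x hx using hx.ne
  have hmul : μ.rnDeriv ρ =ᵐ[ρ]
      (volume : Measure ℝ).rnDeriv ρ * fun x => ENNReal.ofReal (q x) := by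
    filter_upwards [hae, hfin μ inferInstance, hfin volume inferInstance] with x hx h1 h2
    rw [Pi.mul_apply, ← ENNReal.ofReal_toReal h1, hx, ENNReal.ofReal_mul ENNReal.toReal_nonneg,
      ENNReal.ofReal_toReal h2]
  calc μ = ρ.withDensity (μ.rnDeriv ρ) := (Measure.withDensity_rnDeriv_eq μ ρ hμρ).symm
    _ = ρ.withDensity ((volume : Measure ℝ).rnDeriv ρ * fun x => ENNReal.ofReal (q x)) :=
      withDensity_congr_ae hmul
    _ = (ρ.withDensity ((volume : Measure ℝ).rnDeriv ρ)).withDensity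
        fun x => ENNReal.ofReal (q x) :=
      withDensity_mul _ (Measure.measurable_rnDeriv _ _) hqc.measurable.ennreal_ofReal
    _ = _ := by rw [Measure.withDensity_rnDeriv_eq _ _ hvρ]

end Density

/-! ### The transition density of the Lévy process. -/

section TransitionDensity

variable {Ω' : Type*} [MeasurableSpace Ω'] {X : ℝ≥0 → Ω' → ℝ} {P' : Measure Ω'}

/-- The symbol at `r` has modulus `|symbol (r / 2)|²`. Since `|symbol s|²` decreases in `s`, this is
at most `2 / r` times the energy at time `r / 2`. -/
lemma integrable_symbol [IsProbabilityMeasure P'] (hX : IsLevyProcess X P')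
    (hE : ∀ t, 0 ≤ t → MemLp (fun ξ => (√(energy X P' t ξ) : ℂ)) 2 volume) {r : ℝ} (hr : 0 < r) :
    Integrable (symbol X P' r) := by
  have hr2 : 0 < r / 2 := half_pos hr
  have h1 := (memLp_two_iff_integrable_sq_norm (hE _ hr2.le).1).1 (hE _ hr2.le)
  have h2 : ∀ ξ, ‖(√(energy X P' (r / 2) ξ) : ℂ)‖ ^ 2 = energy X P' (r / 2) ξ := fun ξ => by
    rw [Complex.norm_real, Real.norm_of_nonneg (Real.sqrt_nonneg _),
      Real.sq_sqrt (energy_nonneg hr2.le ξ)]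
  simp only [h2] at h1
  refine (h1.const_mul (r / 2)⁻¹).mono' (continuous_symbol_freq hX r).aestronglyMeasurable
    (ae_of_all _ fun ξ => ?_)
  have h3 : ‖symbol X P' r ξ‖ = ‖symbol X P' (r / 2) ξ‖ ^ 2 := by
    have := symbol_add hX hr2.le hr2.le ξ
    rw [add_halves] at this
    rw [this, norm_mul, sq]
  have hcont : Continuous fun r => ‖symbol X P' r ξ‖ ^ 2 :=
    (continuous_symbol_time hX ξ).norm.pow 2
  have h4 : ∫ s in (0 : ℝ)..(r / 2), ‖symbol X P' (r / 2) ξ‖ ^ 2 ≤ energy X P' (r / 2) ξ := by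
    refine intervalIntegral.integral_mono_on hr2.le (by simp) (hcont.intervalIntegrable _ _) ?_
    intro s hs
    rw [norm_symbol_sq hX hs.1, norm_symbol_sq hX hr2.le]
    have := exponent_nonneg hX ξ
    apply Real.exp_le_exp.2
    gcongr
    exact hs.2
  simp only [intervalIntegral.integral_const, sub_zero, smul_eq_mul] at h4
  rw [h3, le_inv_mul_iff₀ hr2]
  exact h4

/-- The transition density obtained from the Fourier inversion formula. -/
def transitionDensity (X : ℝ≥0 → Ω' → ℝ) (P' : Measure Ω') (t x : ℝ) : ℝ :=
  max (𝓕 (fun ξ => symbol X P' t (-ξ)) x).re 0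

theorem isTransitionDensity [IsProbabilityMeasure P'] (hX : IsLevyProcess X P')
    (hE : ∀ t, 0 ≤ t → MemLp (fun ξ => (√(energy X P' t ξ) : ℂ)) 2 volume) :
    IsTransitionDensity X P' (transitionDensity X P') where
  measurable := by
    refine Measurable.max (Complex.measurable_re.comp ?_) measurable_const
    simp only [Real.fourier_real_eq_integral_exp_smul]
    refine (StronglyMeasurable.integral_prod_right (f := fun (z : ℝ × ℝ) (v : ℝ) =>
      Complex.exp (((-2 * Real.pi * v * z.2 : ℝ) : ℂ) * Complex.I) • symbol X P' z.1 (-v))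
      ?_).measurable
    have h1 : Measurable fun y : (ℝ × ℝ) × ℝ => symbol X P' y.1.1 (-y.2) :=
      (measurable_symbol hX).comp (by fun_prop : Measurable fun y : (ℝ × ℝ) × ℝ => (y.1.1, -y.2))
    have h2 : Measurable fun y : (ℝ × ℝ) × ℝ =>
      Complex.exp (((-2 * Real.pi * y.2 * y.1.2 : ℝ) : ℂ) * Complex.I) := by fun_prop
    exact (h2.smul h1).stronglyMeasurable
  nonneg t x := le_max_right _ _
  law t ht := by
    have := isProbabilityMeasure_law hX t.toNNReal
    -- The sign is reversed because `symbol` carries `-2πξ`, whereas inversion uses the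
    -- characteristic function at `2πξ`.
    have e : (fun ξ => symbol X P' t (-ξ))
        = fun ξ : ℝ => charFun (P'.map (X t.toNNReal)) (2 * Real.pi * ξ) := by
      ext ξ
      rw [symbol]
      congr 1
      ring
    have hint : Integrable fun ξ => symbol X P' t (-ξ) := (integrable_symbol hX hE ht).comp_neg
    rw [e] at hint
    refine (eq_withDensity_of_integrable_charFun hint).trans ?_
    congr 1 with x
    rw [transitionDensity, e]
    simp [ENNReal.ofReal_max]

end TransitionDensity

/-! ### Bounds and continuity for the drift integral. -/

section Drift

variable {Ω' : Type*} [MeasurableSpace Ω'] {X : ℝ≥0 → Ω' → ℝ} {P' : Measure Ω'}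
  {p : ℝ → ℝ → ℝ} {b : ℝ → ℝ} {M : ℝ} {u v : ℝ → ℝ → ℝ}

/-- As one integral over a fixed space, with the domain in an indicator, the drift is accessible to
dominated convergence and to measurability in parameters. -/
lemma DriftIntegrable.driftIntegral_eq {t x : ℝ} (h : DriftIntegrable b p u t x) (ht : 0 ≤ t) :
    driftIntegral b p u t x = ∫ z : ℝ × ℝ, (Set.Ioo 0 t ×ˢ (Set.univ : Set ℝ)).indicator
      (fun z => b (u z.1 (x - z.2)) * p (t - z.1) z.2) z := by
  rw [integral_indicator (measurableSet_Ioo.prod MeasurableSet.univ), Measure.volume_eq_prod,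
    setIntegral_prod _ h, Measure.restrict_univ, driftIntegral, intervalIntegral.integral_of_le ht,
    integral_Ioc_eq_integral_Ioo]

lemma IsTransitionDensity.measurable_apply (hp : IsTransitionDensity X P' p) (t : ℝ) :
    Measurable (p t) :=
  hp.measurable.comp (by fun_prop : Measurable fun x : ℝ => (t, x))

variable [IsProbabilityMeasure P']

lemma IsTransitionDensity.lintegral_eq_one (hp : IsTransitionDensity X P' p)
    (hX : IsLevyProcess X P') {t : ℝ} (ht : 0 < t) : ∫⁻ x, ENNReal.ofReal (p t x) = 1 := by
  have := isProbabilityMeasure_law hX t.toNNReal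
  rw [← setLIntegral_univ, ← withDensity_apply _ MeasurableSet.univ, ← hp.law t ht, measure_univ]

lemma IsTransitionDensity.integrable (hp : IsTransitionDensity X P' p)
    (hX : IsLevyProcess X P') {t : ℝ} (ht : 0 < t) : Integrable (p t) := by
  refine ⟨(hp.measurable_apply t).aestronglyMeasurable, ?_⟩
  rw [hasFiniteIntegral_iff_ofReal (ae_of_all _ (hp.nonneg t)), hp.lintegral_eq_one hX ht]
  exact ENNReal.one_lt_top

lemma IsTransitionDensity.integral_eq_one (hp : IsTransitionDensity X P' p)
    (hX : IsLevyProcess X P') {t : ℝ} (ht : 0 < t) : ∫ x, p t x = 1 := by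
  rw [integral_eq_lintegral_of_nonneg_ae (ae_of_all _ (hp.nonneg t))
    (hp.measurable_apply t).aestronglyMeasurable, hp.lintegral_eq_one hX ht, ENNReal.toReal_one]

lemma IsTransitionDensity.integrableOn_prod (hp : IsTransitionDensity X P' p)
    (hX : IsLevyProcess X P') {c : ℝ → ℝ} (hc : Measurable c) {S : Set ℝ} (hS : MeasurableSet S)
    (hSv : volume S ≠ ∞) (hcS : ∀ s ∈ S, 0 < c s) :
    IntegrableOn (fun z : ℝ × ℝ => p (c z.1) z.2) (S ×ˢ Set.univ) := by
  have hm : Measurable fun z : ℝ × ℝ => p (c z.1) z.2 :=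
    hp.measurable.comp (by fun_prop : Measurable fun z : ℝ × ℝ => (c z.1, z.2))
  refine ⟨hm.aestronglyMeasurable, ?_⟩
  rw [hasFiniteIntegral_iff_ofReal (ae_of_all _ fun z => hp.nonneg _ _), Measure.volume_eq_prod,
    ← Measure.prod_restrict, lintegral_prod _ hm.ennreal_ofReal.aemeasurable,
    Measure.restrict_univ]
  calc ∫⁻ s in S, ∫⁻ y, ENNReal.ofReal (p (c s) y) = ∫⁻ _ in S, 1 :=
        setLIntegral_congr_fun hS fun s hs => hp.lintegral_eq_one hX (hcS s hs)
    _ < ∞ := by simpa using hSv.lt_top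

lemma IsTransitionDensity.driftIntegrable (hp : IsTransitionDensity X P' p)
    (hX : IsLevyProcess X P') (hb : Measurable b) (hM : ∀ z, |b z| ≤ M)
    (hu : Measurable fun z : ℝ × ℝ => u z.1 z.2) (t x : ℝ) : DriftIntegrable b p u t x := by
  refine Integrable.bdd_mul (c := M) (hp.integrableOn_prod hX (c := fun s => t - s) (by fun_prop)
    measurableSet_Ioo (by simp) fun s hs => sub_pos.2 hs.2) ?_ (ae_of_all _ fun z => hM _)
  exact (hb.comp (hu.comp (by fun_prop : Measurable fun z : ℝ × ℝ =>
    (z.1, x - z.2)))).aestronglyMeasurable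

lemma IsTransitionDensity.abs_integral_mul_le (hp : IsTransitionDensity X P' p)
    (hX : IsLevyProcess X P') {r : ℝ} (hr : 0 < r) {f : ℝ → ℝ} {c : ℝ} (hf : ∀ y, |f y| ≤ c) :
    |∫ y, f y * p r y| ≤ c := by
  have h := norm_integral_le_of_norm_le ((hp.integrable hX hr).const_mul c)
    (f := fun y => f y * p r y) (ae_of_all _ fun y => by
      rw [norm_mul, Real.norm_of_nonneg (hp.nonneg r y)]
      exact mul_le_mul_of_nonneg_right (hf y) (hp.nonneg r y))
  rwa [integral_const_mul, hp.integral_eq_one hX hr, mul_one] at h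

lemma IsTransitionDensity.abs_driftIntegral_le (hp : IsTransitionDensity X P' p)
    (hX : IsLevyProcess X P') (hM : ∀ z, |b z| ≤ M) {t : ℝ} (ht : 0 ≤ t) (x : ℝ) :
    |driftIntegral b p u t x| ≤ M * t := by
  rw [driftIntegral, intervalIntegral.integral_of_le ht, integral_Ioc_eq_integral_Ioo]
  have := norm_setIntegral_le_of_norm_le_const (μ := volume) (s := Set.Ioo 0 t) (C := M)
    (f := fun s => ∫ y, b (u s (x - y)) * p (t - s) y) (by simp)
    fun s hs => hp.abs_integral_mul_le hX (sub_pos.2 hs.2) fun y => hM _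
  simpa [ht] using this

/-- If `u` and `v` differ by at most `D s` at time `s`, then their drifts differ by at most
`K ∫₀ᵗ D`, where `K` is the Lipschitz constant of `b`. -/
lemma IsTransitionDensity.abs_driftIntegral_sub_le (hp : IsTransitionDensity X P' p)
    (hX : IsLevyProcess X P') {K : ℝ≥0} (hb : LipschitzWith K b) (hM : ∀ z, |b z| ≤ M)
    (hu : Measurable fun z : ℝ × ℝ => u z.1 z.2) (hv : Measurable fun z : ℝ × ℝ => v z.1 z.2)
    {D : ℝ → ℝ} (hD : Continuous D) {t : ℝ} (ht : 0 ≤ t)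
    (h : ∀ s, 0 < s → ∀ y, |u s y - v s y| ≤ D s) (x : ℝ) :
    |driftIntegral b p u t x - driftIntegral b p v t x| ≤ ∫ s in (0 : ℝ)..t, K * D s := by
  have hbm := hb.continuous.measurable
  have hi : ∀ {u : ℝ → ℝ → ℝ}, Measurable (fun z : ℝ × ℝ => u z.1 z.2) →
      IntegrableOn (fun s => ∫ y, b (u s (x - y)) * p (t - s) y) (Set.Ioo 0 t) := fun hu => by
    have := hp.driftIntegrable hX hbm hM hu t x
    rw [DriftIntegrable, IntegrableOn, Measure.volume_eq_prod, ← Measure.prod_restrict,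
      Measure.restrict_univ] at this
    exact this.integral_prod_left
  have hi' : ∀ {u : ℝ → ℝ → ℝ} {s : ℝ}, Measurable (fun z : ℝ × ℝ => u z.1 z.2) → s < t →
      Integrable fun y => b (u s (x - y)) * p (t - s) y := fun {u s} hu hs =>
    Integrable.bdd_mul (c := M) (hp.integrable hX (sub_pos.2 hs)) (hbm.comp (hu.comp
      (by fun_prop : Measurable fun y : ℝ => (s, x - y)))).aestronglyMeasurable
      (ae_of_all _ fun z => hM _)
  rw [driftIntegral, driftIntegral, intervalIntegral.integral_of_le ht,
    intervalIntegral.integral_of_le ht, intervalIntegral.integral_of_le ht,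
    integral_Ioc_eq_integral_Ioo, integral_Ioc_eq_integral_Ioo, integral_Ioc_eq_integral_Ioo,
    ← integral_sub (hi hu) (hi hv), ← Real.norm_eq_abs]
  refine norm_integral_le_of_norm_le (g := fun s => K * D s) ?_ ?_
  · exact (Continuous.integrableOn_Icc (f := fun s => K * D s) (by fun_prop)).mono_set
      Set.Ioo_subset_Icc_self
  · filter_upwards [ae_restrict_mem measurableSet_Ioo] with s hs
    rw [← integral_sub (hi' hu hs.2) (hi' hv hs.2)]
    simp only [← sub_mul]
    refine hp.abs_integral_mul_le hX (sub_pos.2 hs.2) fun y => ?_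
    refine (hb.dist_le_mul _ _).trans ?_
    exact mul_le_mul_of_nonneg_left (h s hs.1 _) K.2

/-- The drift integral is jointly continuous, as the convolution of a bounded function with an
integrable one. -/
theorem IsTransitionDensity.continuousOn_driftIntegral (hp : IsTransitionDensity X P' p)
    (hX : IsLevyProcess X P') (hb : Measurable b) (hM : ∀ z, |b z| ≤ M)
    (hu : Measurable fun z : ℝ × ℝ => u z.1 z.2) (T : ℝ) :
    ContinuousOn (fun z : ℝ × ℝ => driftIntegral b p u z.1 z.2) (Set.Icc 0 T ×ˢ Set.univ) := by
  -- With `g` cut off at negative times and `q` supported in `(0, T]`, the product `g ζ * q (a - ζ)`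
  -- lives exactly on `0 < s < t`. The drift becomes a convolution over the plane, and continuity of
  -- translations in `L¹` applies to `q`.
  set g : ℝ × ℝ → ℝ := fun ζ => if 0 < ζ.1 then b (u ζ.1 ζ.2) else 0 with hg
  set q : ℝ × ℝ → ℝ :=
    (Set.Ioc 0 T ×ˢ (Set.univ : Set ℝ)).indicator fun z => p z.1 z.2 with hq
  have hM0 : 0 ≤ M := (abs_nonneg _).trans (hM 0)
  have hgm : Measurable g :=
    Measurable.ite (measurableSet_lt measurable_const measurable_fst) (hb.comp hu) measurable_const
  have hgM : ∀ ζ, ‖g ζ‖ ≤ M := fun ζ => by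
    rw [hg]
    dsimp only
    split_ifs
    · exact hM _
    · simpa using hM0
  have hqi : Integrable q := (integrable_indicator_iff
    (measurableSet_Ioc.prod MeasurableSet.univ)).2 (hp.integrableOn_prod hX measurable_id
      measurableSet_Ioc (by simp) fun s hs => hs.1)
  have hqa : ∀ a : ℝ × ℝ, Integrable fun ζ => q (a - ζ) := fun a => hqi.comp_sub_left a
  have hgq : ∀ a : ℝ × ℝ, Integrable fun ζ => g ζ * q (a - ζ) := fun a =>
    Integrable.bdd_mul (c := M) (hqa a) hgm.aestronglyMeasurable (ae_of_all _ hgM)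
  have hJ : ∀ a ∈ Set.Icc 0 T ×ˢ (Set.univ : Set ℝ),
      driftIntegral b p u a.1 a.2 = ∫ ζ, g ζ * q (a - ζ) := by
    rintro ⟨t, x⟩ ⟨⟨ht0, htT⟩, -⟩
    rw [driftIntegral, intervalIntegral.integral_of_le ht0, integral_Ioc_eq_integral_Ioo,
      ← integral_indicator measurableSet_Ioo, Measure.volume_eq_prod,
      integral_prod _ (by rw [← Measure.volume_eq_prod]; exact hgq (t, x))]
    congr 1 with s
    rw [← integral_sub_left_eq_self (fun y => g (s, y) * q ((t, x) - (s, y))) volume x]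
    by_cases hs : s ∈ Set.Ioo 0 t
    · have h1 : t - s ∈ Set.Ioc 0 T := ⟨sub_pos.2 hs.2, by linarith [hs.1]⟩
      simp [hs, hg, hq, hs.1, h1.1, h1.2, Set.indicator]
    · rw [Set.indicator_of_notMem hs, eq_comm]
      refine integral_eq_zero_of_ae (ae_of_all _ fun y => ?_)
      by_cases h0 : 0 < s
      · have : ¬ s < t := fun h => hs ⟨h0, h⟩
        simp [hq, this]
      · simp [hg, h0]
  refine ContinuousOn.congr (f := fun a => ∫ ζ, g ζ * q (a - ζ)) ?_ hJ
  refine Continuous.continuousOn (continuous_iff_continuousAt.2 fun a₀ => ?_)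
  have hlim := tendsto_eLpNorm_comp_sub_left (p := 1) ENNReal.one_ne_top
    (memLp_one_iff_integrable.2 hqi) a₀
  have hlim' := (ENNReal.tendsto_toReal ENNReal.zero_ne_top).comp hlim |>.const_mul M
  rw [ContinuousAt, tendsto_iff_dist_tendsto_zero]
  refine squeeze_zero (fun _ => dist_nonneg) (fun a => ?_) (by simpa using hlim')
  have hd : Integrable fun ζ => q (a - ζ) - q (a₀ - ζ) := (hqa a).sub (hqa a₀)
  rw [Real.dist_eq, ← integral_sub (hgq a) (hgq a₀)]
  rw [eLpNorm_one_eq_lintegral_enorm, ← integral_norm_eq_lintegral_enorm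
      hd.aestronglyMeasurable, ← integral_const_mul, ← Real.norm_eq_abs]
  refine norm_integral_le_of_norm_le (hd.norm.const_mul M)
    (ae_of_all _ fun ζ => ?_)
  rw [← mul_sub, norm_mul]
  exact mul_le_mul_of_nonneg_right (hgM ζ) (norm_nonneg _)

end Drift

/-! ### Pathwise solution by Picard's iteration. -/

section Picard

variable {Ω' : Type*} [MeasurableSpace Ω'] {X : ℝ≥0 → Ω' → ℝ} {P' : Measure Ω'}
  {p : ℝ → ℝ → ℝ} {b : ℝ → ℝ} {M : ℝ} {K : ℝ≥0} {h : ℝ → ℝ → ℝ}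

/-- Picard's iteration for the equation `v = driftIntegral b p (h + v)`. -/
def picard (b : ℝ → ℝ) (p h : ℝ → ℝ → ℝ) : ℕ → ℝ → ℝ → ℝ
  | 0 => fun _ _ => 0
  | n + 1 => fun t x =>
    if 0 ≤ t then driftIntegral b p (fun s y => h s y + picard b p h n s y) t x else 0

/-- The value zero at negative times makes the iteration converge at every real `t`, so that the
limit is measurable on the whole product space; the drift at `t ≥ 0` does not see it. -/
lemma picard_of_neg {t : ℝ} (ht : t < 0) (n : ℕ) (x : ℝ) : picard b p h n t x = 0 := by
  cases n <;> simp [picard, ht]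

variable [IsProbabilityMeasure P']

/-- The parameter `ω` is carried along so that every iterate, and hence the solution, is jointly
measurable in `(t, x, ω)`. -/
lemma IsTransitionDensity.measurable_driftIntegral (hp : IsTransitionDensity X P' p)
    (hX : IsLevyProcess X P') (hb : Measurable b) (hM : ∀ z, |b z| ≤ M)
    {Ω : Type*} [MeasurableSpace Ω] {U : ℝ → ℝ → Ω → ℝ}
    (hU : Measurable fun q : ℝ × ℝ × Ω => U q.1 q.2.1 q.2.2) :
    Measurable fun q : ℝ × ℝ × Ω =>
      if 0 ≤ q.1 then driftIntegral b p (fun s y => U s y q.2.2) q.1 q.2.1 else 0 := by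
  have e : (fun q : ℝ × ℝ × Ω =>
      if 0 ≤ q.1 then driftIntegral b p (fun s y => U s y q.2.2) q.1 q.2.1 else 0)
      = fun q : ℝ × ℝ × Ω => if 0 ≤ q.1 then ∫ z : ℝ × ℝ,
        (Set.Ioo 0 q.1 ×ˢ (Set.univ : Set ℝ)).indicator
          (fun z => b (U z.1 (q.2.1 - z.2) q.2.2) * p (q.1 - z.1) z.2) z else 0 := by
    ext q
    split_ifs with hq
    · refine (hp.driftIntegrable hX hb hM ?_ _ _).driftIntegral_eq hq
      exact hU.comp (by fun_prop : Measurable fun z : ℝ × ℝ => (z.1, z.2, q.2.2))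
    · rfl
  rw [e]
  refine Measurable.ite (measurableSet_le measurable_const measurable_fst) ?_ measurable_const
  have h1 : Measurable fun y : (ℝ × ℝ × Ω) × ℝ × ℝ => U y.2.1 (y.1.2.1 - y.2.2) y.1.2.2 :=
    hU.comp (by fun_prop : Measurable fun y : (ℝ × ℝ × Ω) × ℝ × ℝ =>
      (y.2.1, y.1.2.1 - y.2.2, y.1.2.2))
  have h2 : Measurable fun y : (ℝ × ℝ × Ω) × ℝ × ℝ => p (y.1.1 - y.2.1) y.2.2 :=
    hp.measurable.comp (by fun_prop : Measurable fun y : (ℝ × ℝ × Ω) × ℝ × ℝ =>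
      (y.1.1 - y.2.1, y.2.2))
  have h3 : MeasurableSet ({y : (ℝ × ℝ × Ω) × ℝ × ℝ | 0 < y.2.1} ∩ {y | y.2.1 < y.1.1}) :=
    (measurableSet_lt (by fun_prop) (by fun_prop)).inter
      (measurableSet_lt (by fun_prop) (by fun_prop))
  have h4 := ((hb.comp h1).mul h2).indicator h3
  refine (StronglyMeasurable.integral_prod_right (f := fun (q : ℝ × ℝ × Ω) (z : ℝ × ℝ) =>
    (Set.Ioo 0 q.1 ×ˢ (Set.univ : Set ℝ)).indicator
      (fun z => b (U z.1 (q.2.1 - z.2) q.2.2) * p (q.1 - z.1) z.2) z) ?_).measurable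
  refine Measurable.stronglyMeasurable ?_
  convert h4 using 1
  ext y
  simp [Function.uncurry, Set.indicator]

lemma measurable_picard (hp : IsTransitionDensity X P' p)
    (hX : IsLevyProcess X P') (hb : Measurable b) (hM : ∀ z, |b z| ≤ M)
    {Ω : Type*} [MeasurableSpace Ω] {H : ℝ → ℝ → Ω → ℝ}
    (hH : Measurable fun q : ℝ × ℝ × Ω => H q.1 q.2.1 q.2.2) (n : ℕ) :
    Measurable fun q : ℝ × ℝ × Ω => picard b p (fun s y => H s y q.2.2) n q.1 q.2.1 := by
  induction n with
  | zero => exact measurable_const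
  | succ n ih =>
    exact hp.measurable_driftIntegral hX hb hM
      (U := fun s y ω => H s y ω + picard b p (fun s y => H s y ω) n s y) (hH.add ih)

lemma measurable_picard_apply (hp : IsTransitionDensity X P' p)
    (hX : IsLevyProcess X P') (hb : Measurable b) (hM : ∀ z, |b z| ≤ M)
    (hh : Measurable fun z : ℝ × ℝ => h z.1 z.2) (n : ℕ) :
    Measurable fun z : ℝ × ℝ => picard b p h n z.1 z.2 :=
  (measurable_picard hp hX hb hM (H := fun s y (_ : Unit) => h s y)
    (hh.comp (by fun_prop : Measurable fun q : ℝ × ℝ × Unit => (q.1, q.2.1))) n).comp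
    (by fun_prop : Measurable fun z : ℝ × ℝ => (z.1, z.2, ()))

/-- The first difference is at most `M t`; every further one gains a factor `K` and a time
integration, whence the factorial. -/
lemma abs_picard_succ_sub_le (hp : IsTransitionDensity X P' p)
    (hX : IsLevyProcess X P') (hb : LipschitzWith K b) (hM : ∀ z, |b z| ≤ M)
    (hh : Measurable fun z : ℝ × ℝ => h z.1 z.2) (n : ℕ) {t : ℝ} (ht : 0 ≤ t) (x : ℝ) :
    |picard b p h (n + 1) t x - picard b p h n t x|
      ≤ M * K ^ n * t ^ (n + 1) / (n + 1).factorial := by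
  have hbm := hb.continuous.measurable
  induction n generalizing t x with
  | zero =>
    simpa [picard, ht] using hp.abs_driftIntegral_le hX hM ht x (u := fun s y => h s y + 0)
  | succ n ih =>
    have hm := measurable_picard_apply hp hX hbm hM hh
    have := hp.abs_driftIntegral_sub_le hX hb hM (hh.add (hm (n + 1))) (hh.add (hm n))
      (u := fun s y => h s y + picard b p h (n + 1) s y)
      (v := fun s y => h s y + picard b p h n s y)
      (D := fun s => M * K ^ n * s ^ (n + 1) / (n + 1).factorial) (by fun_prop) ht
      (fun s hs y => by simpa using ih hs.le y) x
    have e : ∀ k, picard b p h (k + 1) t x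
        = driftIntegral b p (fun s y => h s y + picard b p h k s y) t x := fun k => if_pos ht
    rw [e (n + 1), e n]
    refine this.trans_eq ?_
    have e : ∀ s : ℝ, K * (M * K ^ n * s ^ (n + 1) / (n + 1).factorial)
        = M * K ^ (n + 1) / (n + 1).factorial * s ^ (n + 1) := fun s => by ring
    simp only [e, intervalIntegral.integral_const_mul, integral_pow]
    rw [Nat.factorial_succ (n + 1)]
    have := (n + 1).factorial_ne_zero
    push_cast
    field_simp
    simp

lemma exists_tendsto_picard (hp : IsTransitionDensity X P' p)
    (hX : IsLevyProcess X P') (hb : LipschitzWith K b) (hM : ∀ z, |b z| ≤ M)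
    (hh : Measurable fun z : ℝ × ℝ => h z.1 z.2) (t x : ℝ) :
    ∃ v, Tendsto (fun n => picard b p h n t x) atTop (𝓝 v) := by
  rcases lt_or_ge t 0 with ht | ht
  · exact ⟨0, by simp [picard_of_neg ht]⟩
  refine cauchySeq_tendsto_of_complete (cauchySeq_of_dist_le_of_summable
    (fun n : ℕ => M * t * ((K * t) ^ n / n.factorial)) (fun n => ?_)
    ((Real.summable_pow_div_factorial _).mul_left _))
  have hM0 : 0 ≤ M := (abs_nonneg _).trans (hM 0)
  rw [dist_comm, Real.dist_eq]
  refine (abs_picard_succ_sub_le hp hX hb hM hh n ht x).trans ?_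
  rw [mul_pow, pow_succ]
  calc M * K ^ n * (t ^ n * t) / (n + 1).factorial
      ≤ M * K ^ n * (t ^ n * t) / n.factorial := by
        gcongr
        exact n.le_succ
    _ = _ := by ring

/-- The limit of Picard's iteration. -/
def picardLimit (b : ℝ → ℝ) (p h : ℝ → ℝ → ℝ) (t x : ℝ) : ℝ :=
  limUnder atTop fun n => picard b p h n t x

lemma tendsto_picardLimit (hp : IsTransitionDensity X P' p)
    (hX : IsLevyProcess X P') (hb : LipschitzWith K b) (hM : ∀ z, |b z| ≤ M)
    (hh : Measurable fun z : ℝ × ℝ => h z.1 z.2) (t x : ℝ) :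
    Tendsto (fun n => picard b p h n t x) atTop (𝓝 (picardLimit b p h t x)) :=
  tendsto_nhds_limUnder (exists_tendsto_picard hp hX hb hM hh t x)

lemma measurable_picardLimit (hp : IsTransitionDensity X P' p)
    (hX : IsLevyProcess X P') (hb : LipschitzWith K b) (hM : ∀ z, |b z| ≤ M)
    {Ω : Type*} [MeasurableSpace Ω] {H : ℝ → ℝ → Ω → ℝ}
    (hH : Measurable fun q : ℝ × ℝ × Ω => H q.1 q.2.1 q.2.2) :
    Measurable fun q : ℝ × ℝ × Ω => picardLimit b p (fun s y => H s y q.2.2) q.1 q.2.1 :=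
  measurable_of_tendsto_metrizable
    (fun n => measurable_picard hp hX hb.continuous.measurable hM hH n)
    (tendsto_pi_nhds.2 fun q => tendsto_picardLimit hp hX hb hM
      (hH.comp (by fun_prop : Measurable fun z : ℝ × ℝ => (z.1, z.2, q.2.2))) _ _)

/-- The fixed-point equation follows from continuity of `b` and dominated convergence, with the
integrable majorant `M p`. -/
theorem picardLimit_eq_driftIntegral (hp : IsTransitionDensity X P' p)
    (hX : IsLevyProcess X P') (hb : LipschitzWith K b) (hM : ∀ z, |b z| ≤ M)
    (hh : Measurable fun z : ℝ × ℝ => h z.1 z.2) {t : ℝ} (ht : 0 ≤ t) (x : ℝ) :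
    picardLimit b p h t x
      = driftIntegral b p (fun s y => h s y + picardLimit b p h s y) t x := by
  have hbm := hb.continuous.measurable
  have hm := measurable_picard_apply hp hX hbm hM hh
  have hlim := tendsto_picardLimit hp hX hb hM hh
  have hml : Measurable fun z : ℝ × ℝ => picardLimit b p h z.1 z.2 :=
    measurable_of_tendsto_metrizable hm (tendsto_pi_nhds.2 fun z => hlim z.1 z.2)
  refine tendsto_nhds_unique ((tendsto_add_atTop_iff_nat 1).2 (hlim t x)) ?_
  simp only [picard, if_pos ht]
  have hi := fun n => hp.driftIntegrable hX hbm hM (hh.add (hm n)) t x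
    (u := fun s y => h s y + picard b p h n s y)
  rw [(hp.driftIntegrable hX hbm hM (hh.add hml) t x
    (u := fun s y => h s y + picardLimit b p h s y)).driftIntegral_eq ht]
  simp only [(hi _).driftIntegral_eq ht]
  have hS : MeasurableSet (Set.Ioo 0 t ×ˢ (Set.univ : Set ℝ)) :=
    measurableSet_Ioo.prod MeasurableSet.univ
  have hbd : IntegrableOn (fun z : ℝ × ℝ => M * p (t - z.1) z.2) (Set.Ioo 0 t ×ˢ Set.univ) :=
    (hp.integrableOn_prod hX (c := fun s => t - s) (by fun_prop)
      measurableSet_Ioo (by simp) fun s hs => sub_pos.2 hs.2).const_mul M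
  refine tendsto_integral_of_dominated_convergence _
    (fun n => ((integrable_indicator_iff hS).2 (hi n)).aestronglyMeasurable)
    ((integrable_indicator_iff hS).2 hbd) (fun n => ae_of_all _ fun z => ?_)
    (ae_of_all _ fun z => ?_)
  · rw [norm_indicator_eq_indicator_norm]
    refine Set.indicator_le_indicator ?_
    rw [norm_mul, Real.norm_of_nonneg (hp.nonneg _ _)]
    exact mul_le_mul_of_nonneg_right (hM _) (hp.nonneg _ _)
  · by_cases hz : z ∈ Set.Ioo 0 t ×ˢ (Set.univ : Set ℝ)
    · simp only [Set.indicator_of_mem hz]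
      exact ((hb.continuous.tendsto _).comp ((hlim _ _).const_add _)).mul_const _
    · simp only [Set.indicator_of_notMem hz]
      exact tendsto_const_nhds

end Picard

/-! ### Stability of boundedness and explosion under perturbation. -/

section Consequences

variable {f g J : ℝ → ℝ → ℝ}

lemma BoundedOn.mono {A B : Set (ℝ × ℝ)} (hf : BoundedOn f B) (h : A ⊆ B) : BoundedOn f A :=
  hf.imp fun _ hC z hz => hC z (h hz)

lemma BoundedOn.iff_of_eq_add {A : Set (ℝ × ℝ)} (h : ∀ z ∈ A, f z.1 z.2 = g z.1 z.2 + J z.1 z.2)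
    (hJ : BoundedOn J A) : BoundedOn f A ↔ BoundedOn g A := by
  obtain ⟨C', hC'⟩ := hJ
  constructor
  · rintro ⟨C, hC⟩
    refine ⟨C + C', fun z hz => ?_⟩
    rw [← add_sub_cancel_right (g z.1 z.2) (J z.1 z.2), ← h z hz]
    exact (abs_sub _ _).trans (add_le_add (hC z hz) (hC' z hz))
  · rintro ⟨C, hC⟩
    refine ⟨C + C', fun z hz => ?_⟩
    rw [h z hz]
    exact (abs_add_le _ _).trans (add_le_add (hC z hz) (hC' z hz))

/-- Explosion at a point is insensitive to locally bounded perturbations. -/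
lemma BlowsUpAt.iff_of_eq_add {z : ℝ × ℝ}
    (h : ∀ z ∈ spaceTime, f z.1 z.2 = g z.1 z.2 + J z.1 z.2)
    (hJ : ∃ U ∈ 𝓝 z, BoundedOn J (U ∩ spaceTime)) : BlowsUpAt f z ↔ BlowsUpAt g z := by
  obtain ⟨U, hU, hJ⟩ := hJ
  have key : ∀ V : Set (ℝ × ℝ),
      BoundedOn f (V ∩ U ∩ spaceTime) ↔ BoundedOn g (V ∩ U ∩ spaceTime) := fun V =>
    BoundedOn.iff_of_eq_add (fun z hz => h z hz.2)
      (hJ.mono (Set.inter_subset_inter_left _ Set.inter_subset_right))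
  constructor
  · intro hf V hV hg
    exact hf (V ∩ U) (inter_mem hV hU) ((key V).2 (hg.mono
      (Set.inter_subset_inter_left _ Set.inter_subset_left)))
  · intro hg V hV hf
    exact hg (V ∩ U) (inter_mem hV hU) ((key V).1 (hf.mono
      (Set.inter_subset_inter_left _ Set.inter_subset_left)))

end Consequences

end SemilinearHeat

end

/-! ### The semilinear equation. -/

theorem theorem8p2
    {Ω Ω' : Type*} [MeasurableSpace Ω] [MeasurableSpace Ω']
    (P : Measure Ω) [IsProbabilityMeasure P] [P.IsComplete]
    (P' : Measure Ω') [IsProbabilityMeasure P']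
    (X : ℝ≥0 → Ω' → ℝ) (hX : SemilinearHeat.IsLevyProcess X P')
    (w : Lp ℝ 2 SemilinearHeat.spaceTimeMeasure → Ω → ℝ) (hw : SemilinearHeat.IsWhiteNoise w P)
    (b : ℝ → ℝ) (hb_bdd : ∃ M : ℝ, ∀ z, |b z| ≤ M) (hb_lip : ∃ L : ℝ≥0, LipschitzWith L b)
    (H : ℝ → ℝ → Ω → ℝ) (hH : SemilinearHeat.IsRandomFieldSolution w P X P' H) :
    -- the transition density of the Lévy process, the modification of `H`, and the process `H_b`
    ∃ p : ℝ → ℝ → ℝ, SemilinearHeat.IsTransitionDensity X P' p ∧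
    ∃ H' Hb : ℝ → ℝ → Ω → ℝ,
      Measurable (fun q : ℝ × ℝ × Ω => H' q.1 q.2.1 q.2.2) ∧
      Measurable (fun q : ℝ × ℝ × Ω => Hb q.1 q.2.1 q.2.2) ∧
      (∀ t : ℝ, 0 ≤ t → ∀ x : ℝ, ∀ᵐ ω ∂P, H' t x ω = H t x ω) ∧
      -- local integrability
      (∀ᵐ ω ∂P, ∀ q : ℝ≥0∞, 1 ≤ q → q ≠ ∞ →
        SemilinearHeat.MemLpLoc (fun t x => Hb t x ω) q) ∧
      -- the random integral equation, at all points simultaneously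
      (∀ᵐ ω ∂P, ∀ t : ℝ, 0 ≤ t → ∀ x : ℝ,
        SemilinearHeat.DriftIntegrable b p (fun s y => Hb s y ω) t x ∧
        Hb t x ω = H' t x ω + SemilinearHeat.driftIntegral b p (fun s y => Hb s y ω) t x) ∧
      -- boundedness and continuity of `J`
      (∀ᵐ ω ∂P, ∀ T : ℝ, 0 < T →
        SemilinearHeat.BoundedOn
          (SemilinearHeat.driftIntegral b p (fun s y => Hb s y ω)) (Set.Icc 0 T ×ˢ Set.univ) ∧
        ContinuousOn
          (fun z : ℝ × ℝ => SemilinearHeat.driftIntegral b p (fun s y => Hb s y ω) z.1 z.2)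
          (Set.Icc 0 T ×ˢ Set.univ)) ∧
      -- `H_b` and `H` are continuous, bounded, and blow up together
      (∀ᵐ ω ∂P,
        (∀ z ∈ SemilinearHeat.spaceTime,
          (ContinuousWithinAt (fun z : ℝ × ℝ => Hb z.1 z.2 ω) SemilinearHeat.spaceTime z ↔
            ContinuousWithinAt (fun z : ℝ × ℝ => H' z.1 z.2 ω) SemilinearHeat.spaceTime z) ∧
          (SemilinearHeat.BlowsUpAt (fun t x => Hb t x ω) z ↔
            SemilinearHeat.BlowsUpAt (fun t x => H' t x ω) z)) ∧
        (∀ T : ℝ, 0 < T → ∀ A : Set (ℝ × ℝ), A ⊆ Set.Icc 0 T ×ˢ Set.univ →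
          (SemilinearHeat.BoundedOn (fun t x => Hb t x ω) A ↔
            SemilinearHeat.BoundedOn (fun t x => H' t x ω) A))) := by
  open SemilinearHeat in
  obtain ⟨M, hM⟩ := hb_bdd
  obtain ⟨K, hb⟩ := hb_lip
  have hbm := hb.continuous.measurable
  obtain ⟨hE, f, hf, hHf⟩ := hH.exists_continuous_kernel hX hw
  have hp := isTransitionDensity hX hE
  obtain ⟨H', hm, hH'f⟩ := hw.exists_measurable_modification hf
  set p := transitionDensity X P'
  -- Every path of `H'` is measurable, so the iteration can be run for each `ω` separately. The
  -- equation and the properties of `J` then hold for all `ω`; only local integrability needs an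
  -- exceptional null set, inherited from `H'`.
  set v : ℝ → ℝ → Ω → ℝ := fun t x ω => picardLimit b p (fun s y => H' s y ω) t x with hv
  set Hb : ℝ → ℝ → Ω → ℝ := fun t x ω => H' t x ω + v t x ω with hHb
  have hvm : Measurable fun q : ℝ × ℝ × Ω => v q.1 q.2.1 q.2.2 :=
    measurable_picardLimit hp hX hb hM hm
  have hHbm : Measurable fun q : ℝ × ℝ × Ω => Hb q.1 q.2.1 q.2.2 := hm.add hvm
  have hsec : ∀ {U : ℝ → ℝ → Ω → ℝ} (ω : Ω), Measurable (fun q : ℝ × ℝ × Ω => U q.1 q.2.1 q.2.2) →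
      Measurable fun z : ℝ × ℝ => U z.1 z.2 ω := fun ω hU =>
    hU.comp (by fun_prop : Measurable fun z : ℝ × ℝ => (z.1, z.2, ω))
  have hvJ : ∀ ω t, 0 ≤ t → ∀ x, v t x ω = driftIntegral b p (fun s y => Hb s y ω) t x :=
    fun ω t ht x => picardLimit_eq_driftIntegral hp hX hb hM (hsec ω hm) ht x
  have hJM : ∀ ω t, 0 ≤ t → ∀ x, |driftIntegral b p (fun s y => Hb s y ω) t x| ≤ M * t :=
    fun ω t ht x => hp.abs_driftIntegral_le hX hM ht x
  have hM0 : 0 ≤ M := (abs_nonneg _).trans (hM 0)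
  have hJbdd : ∀ ω T, BoundedOn (driftIntegral b p (fun s y => Hb s y ω))
      (Set.Icc 0 T ×ˢ Set.univ) := fun ω T =>
    ⟨M * T, fun z hz => (hJM ω z.1 hz.1.1 z.2).trans (mul_le_mul_of_nonneg_left hz.1.2 hM0)⟩
  have hJc : ∀ ω T, ContinuousOn
      (fun z : ℝ × ℝ => driftIntegral b p (fun s y => Hb s y ω) z.1 z.2)
      (Set.Icc 0 T ×ˢ Set.univ) := fun ω T =>
    hp.continuousOn_driftIntegral hX hbm hM (hsec ω hHbm) T
  have hdec : ∀ ω, ∀ z ∈ spaceTime,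
      Hb z.1 z.2 ω = H' z.1 z.2 ω + driftIntegral b p (fun s y => Hb s y ω) z.1 z.2 :=
    fun ω z hz => by rw [hHb, ← hvJ ω z.1 hz.1 z.2]
  have hnhd : ∀ z : ℝ × ℝ, Set.Iio (z.1 + 1) ×ˢ Set.univ ∈ 𝓝 z := fun z =>
    (isOpen_Iio.prod isOpen_univ).mem_nhds ⟨by simp, trivial⟩
  have hsub : ∀ T : ℝ, Set.Iio T ×ˢ Set.univ ∩ spaceTime ⊆ Set.Icc 0 T ×ˢ (Set.univ : Set ℝ) :=
    fun T z hz => ⟨⟨hz.2.1, le_of_lt hz.1.1⟩, trivial⟩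
  -- Near `z`, the half-plane coincides with the slab of times up to `z.1 + 1`, where continuity is
  -- known.
  have hJcont : ∀ ω, ContinuousOn
      (fun z : ℝ × ℝ => driftIntegral b p (fun s y => Hb s y ω) z.1 z.2) spaceTime := by
    intro ω z hz
    refine ((hJc ω (z.1 + 1)) z ⟨⟨hz.1, by simp⟩, trivial⟩).mono_of_mem_nhdsWithin ?_
    exact mem_of_superset (inter_mem (mem_nhdsWithin_of_mem_nhds (hnhd z)) self_mem_nhdsWithin)
      (hsub _)
  refine ⟨p, hp, H', Hb, hm, hHbm, fun t ht x => ?_, ?_, ae_of_all _ fun ω t ht x =>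
    ⟨hp.driftIntegrable hX hbm hM (hsec ω hHbm) t x, hdec ω (t, x) ⟨ht, trivial⟩⟩,
    ae_of_all _ fun ω T _ => ⟨hJbdd ω T, hJc ω T⟩, ae_of_all _ fun ω => ⟨fun z hz => ⟨?_, ?_⟩,
    fun T _ A hA => ?_⟩⟩
  · filter_upwards [hH'f t x, hHf t ht x] with ω h1 h2
    rw [h1, h2]
  · filter_upwards [hw.ae_memLpLoc hf hm fun t _ x => hH'f t x] with ω hω q _ hq S hS hSs
    have hfin : IsFiniteMeasure ((volume : Measure (ℝ × ℝ)).restrict S) :=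
      ⟨by rw [Measure.restrict_apply_univ]; exact hS.measure_lt_top⟩
    obtain ⟨C, hC⟩ := hS.exists_bound_of_continuousOn ((hJcont ω).mono hSs)
    refine (hω q hq S hS hSs).add (g := fun z : ℝ × ℝ => v z.1 z.2 ω)
      (MemLp.of_bound (hsec ω hvm).aestronglyMeasurable C ?_)
    filter_upwards [ae_restrict_mem hS.measurableSet] with z hz
    rw [hvJ ω z.1 (hSs hz).1 z.2]
    exact hC z hz
  · have hc := hJcont ω z hz
    constructor
    · intro h
      refine (h.sub hc).congr (fun y hy => ?_) ?_
      · rw [Pi.sub_apply, hdec ω y hy, add_sub_cancel_right]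
      · rw [Pi.sub_apply, hdec ω z hz, add_sub_cancel_right]
    · intro h
      exact (h.add hc).congr (fun y hy => hdec ω y hy) (hdec ω z hz)
  · exact BlowsUpAt.iff_of_eq_add (f := fun t x => Hb t x ω) (g := fun t x => H' t x ω) (hdec ω)
      ⟨_, hnhd z, (hJbdd ω _).mono (hsub _)⟩
  · exact BoundedOn.iff_of_eq_add (f := fun t x => Hb t x ω) (g := fun t x => H' t x ω)
      (fun z hz => hdec ω z ⟨(hA hz).1.1, trivial⟩) ((hJbdd ω T).mono hA)
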